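/- Let $\mathbf K$ be a commutative $\mathbb Q$-algebra, $N\ge 1$ an integer, $\mu_N\subset\mathbb C^\times$ the group of $N$-th roots of unity and $\zeta_N=e^{2\pi i/N}$. *Betti side.* Let $F_2$ be the free group on $X_0,X_1$, let $\mathcal I_N$ be the kernel of the algebra morphism $\mathbf KF_2\to\mathbf K\mu_N$ induced by $X_0\mapsto\zeta_N$, $X_1\mapsto1$, and let $\mathcal V^{B}_N=\mathbf KF_2$ be filtered by $\mathcal F^m\mathcal V^B_N=\mathbf KF_2$ for $m\le 0$ and $\mathcal F^m\mathcal V^B_N=\mathcal I_N^m$ for $m>0$. Let $\mathcal W^B_N=\mathbf K\oplus\mathbf KF_2(X_1-1)\subset\mathbf KF_2$, filtered by $\mathcal F^m\mathcal W^B_N=\mathcal W^B_N\cap\mathcal F^m\mathcal V^B_N$ ($m\in\mathbb Z$), and let $\mathcal F^m(\mathcal W^B_N\otimes\mathcal W^B_N)=\sum_{i+j=m}\operatorname{im}(\mathcal F^i\mathcal W^B_N\otimes\mathcal F^j\mathcal W^B_N)$. For a filtered algebra $A$ write $\operatorname{gr}(A)=\bigoplus_{m\in\mathbb Z}\mathcal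 F^mA/\mathcal F^{m+1}A$, and $[a]_m$ for the class of $a\in\mathcal F^mA$. Let $\Delta^{\mathcal W,B}:\mathcal W^B_N\to\mathcal W^B_N\otimes\mathcal W^B_N$ be the unique algebra morphism with $X_1^{-1}\mapsto X_1^{-1}\otimes X_1^{-1}$ and, for $n\in\mathbb Z$, $$X_0^n(X_1-1)\mapsto X_0^n(X_1-1)\otimes1+1\otimes X_0^n(X_1-1)-\sum_{k=1}^{n-1}X_0^k(X_1-1)\otimes X_0^{n-k}(X_1-1),$$ where $\sum_{k=p}^q f(k)$ means $0$ if $q=p-1$ and $-\sum_{k=q+1}^{p-1}f(k)$ if $q<p-1$. *De Rham side.* Let $\mathcal V^{DR}_N$ be the graded $\mathbf K$-algebra generated by $e_0,e_1$ (degree $1$) and the elements of $\mu_N$ (degree $0$), subject to the relations that the product of two elements of $\mu_N$ is their product in $\mu_N$, that $1\in\mu_N$ is the unit, and that $\zeta e_0=e_0\zeta$ for $\zeta\in\mu_N$. Let $\mathcal W^{DR}_N=\mathbf K\oplus\mathcal V^{DR}_Ne_1$, put $z_{n,\zeta}=-e_0^{n-1}\zeta e_1$ for $n\ge1$, $\zeta\in\mu_N$,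 and let $\Delta^{\mathcal W,DR}_N:\mathcal W^{DR}_N\to\mathcal W^{DR}_N\otimes\mathcal W^{DR}_N$ be the unique algebra morphism with $$z_{n,\zeta}\mapsto z_{n,\zeta}\otimes1+1\otimes z_{n,\zeta}+\sum_{k=1}^{n-1}\sum_{\eta\in\mu_N}z_{k,\eta}\otimes z_{n-k,\zeta\eta^{-1}}.$$ Let $\rho^{\mathcal W}_N:\mathcal W^{DR}_N\to\operatorname{gr}(\mathcal W^B_N)$ be the restriction of the algebra morphism $\rho^{\mathcal V}_N:\mathcal V^{DR}_N\to\operatorname{gr}(\mathcal V^B_N)$ given by $\zeta_N\mapsto[X_0]_0$, $e_0\mapsto[X_0^N-1]_1$, $e_1\mapsto[X_1-1]_1$. **Theorem.** The morphism $\rho^{\mathcal W}_N$ is an isomorphism of graded algebras. Moreover $\Delta^{\mathcal W,B}(\mathcal F^m\mathcal W^B_N)\subset\mathcal F^m(\mathcal W^B_N\otimes\mathcal W^B_N)$ for all $m\in\mathbb Z$, the canonical morphism $\operatorname{gr}(\mathcal W^B_N)\otimes\operatorname{gr}(\mathcal W^B_N)\to\operatorname{gr}(\mathcal W^B_N\otimes\mathcal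 W^B_N)$, $[a]_i\otimes[b]_j\mapsto[a\otimes b]_{i+j}$, is an isomorphism, and the resulting graded algebra morphism $\operatorname{gr}(\Delta^{\mathcal W,B}):\operatorname{gr}(\mathcal W^B_N)\to\operatorname{gr}(\mathcal W^B_N)\otimes\operatorname{gr}(\mathcal W^B_N)$ satisfies $$(\rho^{\mathcal W}_N\otimes\rho^{\mathcal W}_N)\circ\Delta^{\mathcal W,DR}_N=\operatorname{gr}(\Delta^{\mathcal W,B})\circ\rho^{\mathcal W}_N.$$ -/

import Mathlib

open scoped TensorProduct DirectSum

/-- A decreasing algebra filtration, indexed by `ℤ`, on a `K`-algebra `A`. -/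
structure AlgFiltration (K A : Type*) [CommRing K] [Ring A] [Algebra K A] where
  F : ℤ → Submodule K A
  anti : Antitone F
  one_mem : (1 : A) ∈ F 0
  mul_mem : ∀ {i j : ℤ} {a b : A}, a ∈ F i → b ∈ F j → a * b ∈ F (i + j)

namespace AlgFiltration

section Gr

variable {K A : Type*} [CommRing K] [Ring A] [Algebra K A] (𝓕 : AlgFiltration K A)

/-- The degree `i` piece `F^i / F^(i+1)` of the associated graded algebra. -/
def Piece (i : ℤ) : Type _ := (𝓕.F i) ⧸ (𝓕.F (i + 1)).submoduleOf (𝓕.F i)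

noncomputable instance (i : ℤ) : AddCommGroup (𝓕.Piece i) :=
  inferInstanceAs (AddCommGroup ((𝓕.F i) ⧸ (𝓕.F (i + 1)).submoduleOf (𝓕.F i)))

noncomputable instance (i : ℤ) : Module K (𝓕.Piece i) :=
  inferInstanceAs (Module K ((𝓕.F i) ⧸ (𝓕.F (i + 1)).submoduleOf (𝓕.F i)))

/-- The projection `F^i → F^i / F^(i+1)`. -/
noncomputable def proj (i : ℤ) : 𝓕.F i →ₗ[K] 𝓕.Piece i :=
  ((𝓕.F (i + 1)).submoduleOf (𝓕.F i)).mkQ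

theorem proj_surjective (i : ℤ) : Function.Surjective (𝓕.proj i) :=
  Submodule.mkQ_surjective _

theorem proj_eq_zero_iff {i : ℤ} (a : 𝓕.F i) : 𝓕.proj i a = 0 ↔ (a : A) ∈ 𝓕.F (i + 1) :=
  Submodule.Quotient.mk_eq_zero ((𝓕.F (i + 1)).submoduleOf (𝓕.F i))

/-- Multiplication of representatives. -/
noncomputable def mulRep (i j : ℤ) : 𝓕.F i →ₗ[K] 𝓕.F j →ₗ[K] 𝓕.Piece (i + j) :=
  LinearMap.mk₂ K (fun a b => 𝓕.proj (i + j) ⟨a * b, 𝓕.mul_mem a.2 b.2⟩)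
    (fun a a' b => by rw [← map_add]; congr 1; ext; simp [add_mul])
    (fun c a b => by rw [← map_smul]; congr 1; ext; simp)
    (fun a b b' => by rw [← map_add]; congr 1; ext; simp [mul_add])
    (fun c a b => by rw [← map_smul]; congr 1; ext; simp)

/-- The product `F^i/F^(i+1) × F^j/F^(j+1) → F^(i+j)/F^(i+j+1)`, `[a] [b] = [a b]`. -/
noncomputable def mulPiece (i j : ℤ) : 𝓕.Piece i →ₗ[K] 𝓕.Piece j →ₗ[K] 𝓕.Piece (i + j) :=
  Submodule.liftQ _ (LinearMap.flip (Submodule.liftQ _ (LinearMap.flip (𝓕.mulRep i j)) (by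
    intro b hb
    ext a
    have h := 𝓕.mul_mem a.2 (show (b : A) ∈ 𝓕.F (j + 1) from hb)
    rw [← add_assoc] at h
    exact (𝓕.proj_eq_zero_iff _).2 h))) (by
    intro a ha
    refine LinearMap.ext fun b => ?_
    obtain ⟨b, rfl⟩ := 𝓕.proj_surjective j b
    have h := 𝓕.mul_mem (show (a : A) ∈ 𝓕.F (i + 1) from ha) b.2
    rw [add_right_comm] at h
    exact (𝓕.proj_eq_zero_iff _).2 h)

theorem mulPiece_proj {i j : ℤ} (a : 𝓕.F i) (b : 𝓕.F j) :
    𝓕.mulPiece i j (𝓕.proj i a) (𝓕.proj j b) =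
      𝓕.proj (i + j) ⟨a * b, 𝓕.mul_mem a.2 b.2⟩ := rfl

theorem mk_proj_eq {i j : ℤ} (h : i = j) {a b : A} (hab : a = b) (ha : a ∈ 𝓕.F i)
    (hb : b ∈ 𝓕.F j) :
    (GradedMonoid.mk i (𝓕.proj i ⟨a, ha⟩) : GradedMonoid 𝓕.Piece) =
      GradedMonoid.mk j (𝓕.proj j ⟨b, hb⟩) := by
  subst h; subst hab; rfl

noncomputable instance : GradedMonoid.GMul 𝓕.Piece where
  mul {i j} a b := 𝓕.mulPiece i j a b

noncomputable instance : GradedMonoid.GOne 𝓕.Piece where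
  one := 𝓕.proj 0 ⟨1, 𝓕.one_mem⟩

noncomputable instance : DirectSum.GRing 𝓕.Piece where
  mul_zero a := map_zero (𝓕.mulPiece _ _ a)
  zero_mul b := LinearMap.map_zero₂ (𝓕.mulPiece _ _) b
  mul_add a b c := map_add (𝓕.mulPiece _ _ a) b c
  add_mul a b c := LinearMap.map_add₂ (𝓕.mulPiece _ _) a b c
  one_mul := by
    rintro ⟨i, a⟩
    obtain ⟨a, rfl⟩ := 𝓕.proj_surjective i a
    exact 𝓕.mk_proj_eq (zero_add i) (one_mul _) _ _
  mul_one := by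
    rintro ⟨i, a⟩
    obtain ⟨a, rfl⟩ := 𝓕.proj_surjective i a
    exact 𝓕.mk_proj_eq (add_zero i) (mul_one _) _ _
  mul_assoc := by
    rintro ⟨i, a⟩ ⟨j, b⟩ ⟨k, c⟩
    obtain ⟨a, rfl⟩ := 𝓕.proj_surjective i a
    obtain ⟨b, rfl⟩ := 𝓕.proj_surjective j b
    obtain ⟨c, rfl⟩ := 𝓕.proj_surjective k c
    exact 𝓕.mk_proj_eq (add_assoc i j k) (mul_assoc _ _ _) _ _
  natCast n := n • 𝓕.proj 0 ⟨1, 𝓕.one_mem⟩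
  natCast_zero := zero_smul _ _
  natCast_succ n := succ_nsmul _ _
  intCast n := n • 𝓕.proj 0 ⟨1, 𝓕.one_mem⟩
  intCast_ofNat n := natCast_zsmul _ _
  intCast_negSucc_ofNat n := negSucc_zsmul _ _

theorem smul_one_mem (c : K) : c • (1 : A) ∈ 𝓕.F 0 := Submodule.smul_mem _ _ 𝓕.one_mem

noncomputable instance : DirectSum.GAlgebra K 𝓕.Piece where
  toFun := AddMonoidHom.mk' (fun c => 𝓕.proj 0 ⟨c • (1 : A), 𝓕.smul_one_mem c⟩) (fun a b => by
    rw [← map_add]; congr 1; ext; simp [add_smul])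
  map_one := by
    change 𝓕.proj 0 _ = 𝓕.proj 0 _
    congr 1; ext; simp
  map_mul r s := 𝓕.mk_proj_eq (zero_add 0).symm (by rw [smul_mul_smul_comm, one_mul]) _ _
  commutes := by
    rintro r ⟨i, a⟩
    obtain ⟨a, rfl⟩ := 𝓕.proj_surjective i a
    exact 𝓕.mk_proj_eq ((zero_add i).trans (add_zero i).symm) (by simp) _ _
  smul_def := by
    rintro r ⟨i, a⟩
    obtain ⟨a, rfl⟩ := 𝓕.proj_surjective i a
    exact 𝓕.mk_proj_eq (zero_add i).symm (by simp) (Submodule.smul_mem _ r a.2) _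

/-- The associated graded algebra `gr(A) = ⨁ i, F^i / F^(i+1)`. -/
abbrev Gr : Type _ := ⨁ i, 𝓕.Piece i

/-- The class `[a]_i ∈ gr(A)` of an element `a ∈ F^i`. -/
noncomputable def cls (i : ℤ) (a : A) (ha : a ∈ 𝓕.F i) : 𝓕.Gr :=
  DirectSum.lof K ℤ 𝓕.Piece i (𝓕.proj i ⟨a, ha⟩)

theorem cls_congr {i j : ℤ} (h : i = j) {a b : A} (hab : a = b) (ha : a ∈ 𝓕.F i)
    (hb : b ∈ 𝓕.F j) : 𝓕.cls i a ha = 𝓕.cls j b hb := by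
  subst h; subst hab; rfl

theorem cls_mul {i j : ℤ} {a b : A} (ha : a ∈ 𝓕.F i) (hb : b ∈ 𝓕.F j) :
    𝓕.cls i a ha * 𝓕.cls j b hb = 𝓕.cls (i + j) (a * b) (𝓕.mul_mem ha hb) :=
  DirectSum.of_mul_of _ _

theorem cls_one : 𝓕.cls 0 1 𝓕.one_mem = 1 := rfl

theorem cls_sub_eq {i : ℤ} {a b : A} (ha : a ∈ 𝓕.F i) (hb : b ∈ 𝓕.F i)
    (h : a - b ∈ 𝓕.F (i + 1)) : 𝓕.cls i a ha = 𝓕.cls i b hb := by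
  unfold cls
  congr 1
  rw [← sub_eq_zero, ← map_sub]
  exact (𝓕.proj_eq_zero_iff _).2 h

theorem gr_induction {p : 𝓕.Gr → Prop} (h0 : p 0) (hadd : ∀ x y, p x → p y → p (x + y))
    (hcls : ∀ i a (ha : a ∈ 𝓕.F i), p (𝓕.cls i a ha)) (x : 𝓕.Gr) : p x := by
  induction x using DirectSum.induction_on with
  | zero => exact h0
  | of i x =>
    obtain ⟨x, rfl⟩ := 𝓕.proj_surjective i x
    exact hcls i x x.2
  | add x y hx hy => exact hadd x y hx hy

variable {B : Type*} [Ring B] [Algebra K B] {𝓕} {𝓖 : AlgFiltration K B}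

/-- A filtered algebra morphism. -/
def IsFiltered (𝓕 : AlgFiltration K A) (𝓖 : AlgFiltration K B) (f : A →ₐ[K] B) : Prop :=
  ∀ (i : ℤ) (a : A), a ∈ 𝓕.F i → f a ∈ 𝓖.F i

/-- The map `F^i A / F^(i+1) A → F^i B / F^(i+1) B` induced by a filtered morphism. -/
noncomputable def mapPiece (f : A →ₐ[K] B) (hf : IsFiltered 𝓕 𝓖 f) (i : ℤ) :
    𝓕.Piece i →ₗ[K] 𝓖.Piece i :=
  Submodule.mapQ _ _ (f.toLinearMap.restrict (hf i)) (fun a ha => hf (i + 1) a ha)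

theorem mapPiece_proj (f : A →ₐ[K] B) (hf : IsFiltered 𝓕 𝓖 f) (i : ℤ) (a : 𝓕.F i) :
    mapPiece f hf i (𝓕.proj i a) = 𝓖.proj i ⟨f a, hf i a a.2⟩ := rfl

/-- The graded algebra morphism `gr(f) : gr(A) → gr(B)`, `[a]_i ↦ [f(a)]_i`, associated with a
filtered algebra morphism `f`. -/
noncomputable def grMap (f : A →ₐ[K] B) (hf : IsFiltered 𝓕 𝓖 f) : 𝓕.Gr →ₐ[K] 𝓖.Gr :=
  DirectSum.toAlgebra K 𝓕.Piece
    (fun i => DirectSum.lof K ℤ 𝓖.Piece i ∘ₗ mapPiece f hf i)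
    (by
      change 𝓖.cls 0 (f 1) (hf 0 1 𝓕.one_mem) = 1
      rw [← cls_one]
      exact cls_congr _ rfl (map_one f) _ _)
    (by
      intro i j a b
      obtain ⟨a, rfl⟩ := 𝓕.proj_surjective i a
      obtain ⟨b, rfl⟩ := 𝓕.proj_surjective j b
      change 𝓖.cls (i + j) (f (a * b)) (hf _ _ (𝓕.mul_mem a.2 b.2)) =
        𝓖.cls i (f a) (hf _ _ a.2) * 𝓖.cls j (f b) (hf _ _ b.2)
      rw [cls_mul]
      exact cls_congr _ rfl (map_mul f _ _) _ _)

theorem grMap_cls (f : A →ₐ[K] B) (hf : IsFiltered 𝓕 𝓖 f) {i : ℤ} {a : A} (ha : a ∈ 𝓕.F i) :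
    grMap f hf (𝓕.cls i a ha) = 𝓖.cls i (f a) (hf i a ha) := by
  unfold grMap cls
  rw [DirectSum.toAlgebra_apply]
  exact DirectSum.toModule_lof K i _

/-- The filtration induced on a subalgebra. -/
def restrict (𝓕 : AlgFiltration K A) (S : Subalgebra K A) : AlgFiltration K S where
  F i := (𝓕.F i).comap S.val.toLinearMap
  anti _ _ h _ ha := 𝓕.anti h ha
  one_mem := 𝓕.one_mem
  mul_mem ha hb := 𝓕.mul_mem ha hb

theorem isFiltered_val (𝓕 : AlgFiltration K A) (S : Subalgebra K A) :
    IsFiltered (𝓕.restrict S) 𝓕 S.val := fun _ _ h => h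

theorem grMap_val_injective (𝓕 : AlgFiltration K A) (S : Subalgebra K A) :
    Function.Injective (grMap S.val (isFiltered_val 𝓕 S)) := by
  have h : ∀ x i, (grMap S.val (isFiltered_val 𝓕 S) x) i =
      mapPiece S.val (isFiltered_val 𝓕 S) i (x i) := by
    intro x i
    induction x using DirectSum.induction_on with
    | zero => simp
    | add x y hx hy => rw [map_add, DirectSum.add_apply, DirectSum.add_apply, hx, hy, map_add]
    | of j x =>
      obtain ⟨x, rfl⟩ := (𝓕.restrict S).proj_surjective j x
      change (grMap S.val (isFiltered_val 𝓕 S) ((𝓕.restrict S).cls j x x.2)) i = _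
      rw [grMap_cls]
      unfold cls
      rw [DirectSum.lof_eq_of]
      by_cases hij : j = i
      · subst hij
        rw [DirectSum.of_eq_same, DirectSum.of_eq_same]
        rfl
      · rw [DirectSum.of_eq_of_ne _ _ _ (Ne.symm hij), DirectSum.of_eq_of_ne _ _ _ (Ne.symm hij),
          map_zero]
  rw [injective_iff_map_eq_zero]
  intro x hx
  refine DFinsupp.ext fun i => ?_
  have hi := h x i
  rw [hx] at hi
  obtain ⟨y, hy⟩ := (𝓕.restrict S).proj_surjective i (x i)
  change x i = 0
  rw [← hy] at hi ⊢
  rw [mapPiece_proj] at hi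
  have h1 := (𝓕.proj_eq_zero_iff _).1 hi.symm
  exact ((𝓕.restrict S).proj_eq_zero_iff _).2 h1

/-- The tensor product filtration
`F^m (A ⊗ B) = ∑_{i + j = m} (image of F^i A ⊗ F^j B in A ⊗ B)`. -/
def tensor (𝓕 : AlgFiltration K A) (𝓖 : AlgFiltration K B) : AlgFiltration K (A ⊗[K] B) where
  F m := ⨆ (i : ℤ) (j : ℤ) (_ : i + j = m),
    Submodule.map₂ (TensorProduct.mk K A B) (𝓕.F i) (𝓖.F j)
  anti := by
    intro m n h
    refine iSup_le fun i => iSup_le fun j => iSup_le fun hij => ?_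
    refine le_trans ?_ (le_iSup_of_le i (le_iSup_of_le (m - i) (le_iSup_of_le (by ring) le_rfl)))
    exact Submodule.map₂_le_map₂_right (𝓖.anti (by omega))
  one_mem := by
    have h : TensorProduct.mk K A B 1 1 ∈
        Submodule.map₂ (TensorProduct.mk K A B) (𝓕.F 0) (𝓖.F 0) :=
      Submodule.apply_mem_map₂ _ 𝓕.one_mem 𝓖.one_mem
    exact Submodule.mem_iSup_of_mem 0 (Submodule.mem_iSup_of_mem 0
      (Submodule.mem_iSup_of_mem (zero_add 0) h))
  mul_mem := by
    intro m n x y hx hy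
    have key : (⨆ (i : ℤ) (j : ℤ) (_ : i + j = m),
          Submodule.map₂ (TensorProduct.mk K A B) (𝓕.F i) (𝓖.F j)) *
        (⨆ (i : ℤ) (j : ℤ) (_ : i + j = n),
          Submodule.map₂ (TensorProduct.mk K A B) (𝓕.F i) (𝓖.F j)) ≤
        ⨆ (i : ℤ) (j : ℤ) (_ : i + j = m + n),
          Submodule.map₂ (TensorProduct.mk K A B) (𝓕.F i) (𝓖.F j) := by
      simp only [Submodule.iSup_mul, Submodule.mul_iSup]
      refine iSup_le fun i => iSup_le fun j => iSup_le fun hij =>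
        iSup_le fun k => iSup_le fun l => iSup_le fun hkl => ?_
      refine le_trans ?_ (le_iSup_of_le (k + i) (le_iSup_of_le (l + j)
        (le_iSup_of_le (by omega) le_rfl)))
      rw [Submodule.map₂_eq_span_image2, Submodule.map₂_eq_span_image2, Submodule.span_mul_span,
        Submodule.span_le]
      rintro _ ⟨_, ⟨a, ha, b, hb, rfl⟩, _, ⟨c, hc, d, hd, rfl⟩, rfl⟩
      simp only [TensorProduct.mk_apply, Algebra.TensorProduct.tmul_mul_tmul]
      exact Submodule.apply_mem_map₂ (TensorProduct.mk K A B) (𝓕.mul_mem ha hc) (𝓖.mul_mem hb hd)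
    exact key (Submodule.mul_mem_mul hx hy)

theorem tmul_mem_tensor {i j m : ℤ} (hm : i + j = m) {a : A} {b : B} (ha : a ∈ 𝓕.F i)
    (hb : b ∈ 𝓖.F j) : a ⊗ₜ[K] b ∈ (𝓕.tensor 𝓖).F m :=
  Submodule.mem_iSup_of_mem i (Submodule.mem_iSup_of_mem j (Submodule.mem_iSup_of_mem hm
    (Submodule.apply_mem_map₂ (TensorProduct.mk K A B) ha hb)))

theorem isFiltered_includeLeft (𝓕 : AlgFiltration K A) (𝓖 : AlgFiltration K B) :
    IsFiltered 𝓕 (𝓕.tensor 𝓖) Algebra.TensorProduct.includeLeft :=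
  fun i _ ha => tmul_mem_tensor (add_zero i) ha 𝓖.one_mem

theorem isFiltered_includeRight (𝓕 : AlgFiltration K A) (𝓖 : AlgFiltration K B) :
    IsFiltered 𝓖 (𝓕.tensor 𝓖) Algebra.TensorProduct.includeRight :=
  fun i _ hb => tmul_mem_tensor (zero_add i) 𝓕.one_mem hb

/-- The canonical algebra morphism `gr(A) ⊗ gr(B) → gr(A ⊗ B)`,
`[a]_i ⊗ [b]_j ↦ [a ⊗ b]_(i+j)`. -/
noncomputable def grTensor (𝓕 : AlgFiltration K A) (𝓖 : AlgFiltration K B) :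
    𝓕.Gr ⊗[K] 𝓖.Gr →ₐ[K] (𝓕.tensor 𝓖).Gr :=
  Algebra.TensorProduct.lift (grMap _ (isFiltered_includeLeft 𝓕 𝓖))
    (grMap _ (isFiltered_includeRight 𝓕 𝓖)) (by
      intro x y
      induction x using gr_induction with
      | h0 => simp
      | hadd x x' hx hx' => rw [map_add]; exact hx.add_left hx'
      | hcls i a ha =>
        induction y using gr_induction with
        | h0 => simp
        | hadd y y' hy hy' => rw [map_add]; exact hy.add_right hy'
        | hcls j b hb =>
          rw [grMap_cls, grMap_cls, commute_iff_eq, cls_mul, cls_mul]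
          exact cls_congr _ (add_comm i j) (by simp) _ _)

theorem grTensor_cls_tmul_cls {i j : ℤ} {a : A} {b : B} (ha : a ∈ 𝓕.F i) (hb : b ∈ 𝓖.F j) :
    grTensor 𝓕 𝓖 (𝓕.cls i a ha ⊗ₜ 𝓖.cls j b hb) =
      (𝓕.tensor 𝓖).cls (i + j) (a ⊗ₜ b) (tmul_mem_tensor rfl ha hb) := by
  unfold grTensor
  rw [Algebra.TensorProduct.lift_tmul, grMap_cls, grMap_cls, cls_mul]
  exact cls_congr _ rfl (by simp) _ _

end Gr

end AlgFiltration

section LeftSub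

variable {K V : Type*} [CommRing K] [Ring V] [Algebra K V]

/-- The subalgebra `K + V x` of a `K`-algebra `V`, for `x ∈ V`. -/
def leftSub (K : Type*) {V : Type*} [CommRing K] [Ring V] [Algebra K V] (x : V) :
    Subalgebra K V where
  carrier := {w | ∃ (c : K) (v : V), w = algebraMap K V c + v * x}
  mul_mem' := by
    rintro _ _ ⟨c, v, rfl⟩ ⟨d, u, rfl⟩
    refine ⟨c * d, algebraMap K V c * u + v * algebraMap K V d + v * x * u, ?_⟩
    rw [map_mul, mul_add, add_mul, add_mul, add_mul, add_mul, mul_assoc v _ x, mul_assoc v x,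
      Algebra.commutes d x]
    simp only [mul_assoc]
    abel
  add_mem' := by
    rintro _ _ ⟨c, v, rfl⟩ ⟨d, u, rfl⟩
    exact ⟨c + d, v + u, by rw [map_add, add_mul]; abel⟩
  algebraMap_mem' c := ⟨c, 0, by simp⟩

theorem mul_mem_leftSub (v x : V) : v * x ∈ leftSub K x := ⟨0, v, by simp⟩

/-- An algebra morphism on `K + V x` obtained from a representation of `V` in which `x` acts with
rank one. -/
theorem exists_algHom_leftSub {A M : Type*} [Ring A] [Algebra K A] [AddCommGroup M] [Module K M]
    [Module Aᵐᵒᵖ M] [IsScalarTower K Aᵐᵒᵖ M] [SMulCommClass Aᵐᵒᵖ K M] {x : V}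
    (ρ : V →ₐ[K] Module.End Aᵐᵒᵖ M) (r : M →ₗ[Aᵐᵒᵖ] Aᵐᵒᵖ) (s : M) (hs : r s = 1)
    (hx : ∀ m, ρ x m = r m • ρ x s) :
    ∃ f : leftSub K x →ₐ[K] A, ∀ w, f w = (r (ρ w s)).unop := by
  have hK : ∀ (c : K) (m : M), ρ (algebraMap K V c) m = c • m := by
    intro c m
    rw [AlgHom.commutes]; rfl
  have hr : ∀ (c : K) (m : M), r (c • m) = c • r m := fun c m => r.map_smul_of_tower c m
  refine ⟨AlgHom.ofLinearMap
    { toFun := fun w => (r (ρ w s)).unop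
      map_add' := fun a b => by simp
      map_smul' := fun c a => by simp [hr] } (by simp [hs]) ?_, fun w => rfl⟩
  rintro ⟨_, c, v, rfl⟩ ⟨w, -⟩
  change (r (ρ ((algebraMap K V c + v * x) * w) s)).unop =
    (r (ρ (algebraMap K V c + v * x) s)).unop * (r (ρ w s)).unop
  rw [← MulOpposite.unop_mul]
  congr 1
  simp only [map_mul, map_add, Module.End.mul_apply, LinearMap.add_apply]
  rw [hK, hK, hr, hr, hs, hx (ρ w s)]
  simp [mul_add]

/-- A subalgebra containing a left ideal through `x` contains `K + V x`. -/
theorem leftSub_le {x : V} (E : Subalgebra K V) (U : Submodule K V) (hUE : ∀ u ∈ U, u ∈ E)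
    (hxU : x ∈ U) (hU : ∀ (v : V), ∀ u ∈ U, v * u ∈ U) : leftSub K x ≤ E := by
  rintro _ ⟨c, v, rfl⟩
  exact E.add_mem (E.algebraMap_mem c) (hUE _ (hU v x hxU))

/-- The elements that stabilise a submodule by left multiplication. -/
def leftStab (U : Submodule K V) : Subalgebra K V where
  carrier := {v | ∀ u ∈ U, v * u ∈ U}
  mul_mem' ha hb u hu := by rw [mul_assoc]; exact ha _ (hb _ hu)
  add_mem' ha hb u hu := by rw [add_mul]; exact U.add_mem (ha _ hu) (hb _ hu)
  algebraMap_mem' c u hu := by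
    rw [← Algebra.smul_def]
    exact U.smul_mem c hu

end LeftSub

/-! ### The Betti side -/

section Betti

variable (K : Type*) [CommRing K]

/-- The group algebra `K F₂`. -/
abbrev VB : Type _ := MonoidAlgebra K (FreeGroup (Fin 2))

/-- The group elements `X₀`, `X₁` of `K F₂`, and their integer powers. -/
noncomputable def bX (i : Fin 2) (n : ℤ) : VB K := MonoidAlgebra.of K _ (FreeGroup.of i ^ n)

theorem bX_zero (i : Fin 2) : bX K i 0 = 1 := by
  unfold bX
  rw [zpow_zero, map_one]

theorem bX_add (i : Fin 2) (m n : ℤ) : bX K i (m + n) = bX K i m * bX K i n := by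
  unfold bX
  rw [zpow_add, map_mul]

/-- `W^B = K ⊕ K F₂ (X₁ - 1)`. -/
noncomputable abbrev WB : Subalgebra K (VB K) := leftSub K (bX K 1 1 - 1)

theorem bX_one_neg_one_mem : bX K 1 (-1) ∈ WB K := by
  refine ⟨1, -bX K 1 (-1), ?_⟩
  rw [mul_sub, neg_mul, neg_mul, ← bX_add, map_one, neg_add_cancel, bX_zero]
  simp

/-- `X₁⁻¹ ∈ W^B`. -/
noncomputable def wX1inv : WB K := ⟨bX K 1 (-1), bX_one_neg_one_mem K⟩

/-- `X₀^n (X₁ - 1) ∈ W^B`. -/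
noncomputable def wY (n : ℤ) : WB K := ⟨bX K 0 n * (bX K 1 1 - 1), mul_mem_leftSub _ _⟩

/-- The sum `∑_{k=p}^q f(k)` for arbitrary integers `p`, `q`, equal to `-(f(q+1) + ⋯ + f(p-1))`
when `q < p - 1`. -/
noncomputable def intSum {M : Type*} [AddCommGroup M] (p q : ℤ) (f : ℤ → M) : M :=
  if p - 1 ≤ q then ∑ k ∈ Finset.Icc p q, f k else -∑ k ∈ Finset.Icc (q + 1) (p - 1), f k

/-- The formulas that characterise the Betti harmonic coproduct. -/
def IsBettiCoproduct (Δ : WB K →ₐ[K] WB K ⊗[K] WB K) : Prop :=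
  Δ (wX1inv K) = wX1inv K ⊗ₜ wX1inv K ∧
  ∀ n : ℤ, Δ (wY K n) = wY K n ⊗ₜ 1 + 1 ⊗ₜ wY K n
    - intSum 1 (n - 1) (fun k => wY K k ⊗ₜ[K] wY K (n - k))

variable {K}

theorem WB_hom_ext {A : Type*} [Ring A] [Algebra K A] {f g : WB K →ₐ[K] A}
    (h1 : f (wX1inv K) = g (wX1inv K)) (h2 : ∀ n, f (wY K n) = g (wY K n)) : f = g := by
  let E : Subalgebra K (VB K) := (AlgHom.equalizer f g).map (WB K).val
  have hY : ∀ n, bX K 0 n * (bX K 1 1 - 1) ∈ E := fun n => ⟨wY K n, h2 n, rfl⟩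
  have hX : bX K 1 (-1) ∈ E := ⟨wX1inv K, h1, rfl⟩
  let U : Submodule K (VB K) := Submodule.span K
    {u | ∃ (n : ℤ) (e : VB K), e ∈ E ∧ u = bX K 0 n * (bX K 1 1 - 1) * e}
  have hUE : ∀ u ∈ U, u ∈ E := by
    intro u hu
    have : U ≤ Subalgebra.toSubmodule E := by
      refine Submodule.span_le.2 ?_
      rintro _ ⟨n, e, he, rfl⟩
      exact E.mul_mem (hY n) he
    exact this hu
  have hgen : ∀ e ∈ E, (bX K 1 1 - 1) * e ∈ U := fun e he =>
    Submodule.subset_span ⟨0, e, he, by rw [bX_zero, one_mul]⟩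
  have h0 : ∀ n, bX K 0 n ∈ leftStab U := by
    intro n u hu
    refine Submodule.span_induction (p := fun u _ => bX K 0 n * u ∈ U) ?_ (by simp)
      (fun a b _ _ ha hb => by rw [mul_add]; exact U.add_mem ha hb)
      (fun c a _ ha => by rw [mul_smul_comm]; exact U.smul_mem c ha) hu
    rintro _ ⟨m, e, he, rfl⟩
    exact Submodule.subset_span ⟨n + m, e, he, by rw [bX_add]; simp only [mul_assoc]⟩
  have h1' : bX K 1 1 ∈ leftStab U := by
    intro u hu
    have := U.add_mem hu (hgen u (hUE u hu))
    rwa [sub_mul, one_mul, add_sub_cancel] at this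
  have h1n : bX K 1 (-1) ∈ leftStab U := by
    intro u hu
    have h := U.sub_mem hu (hgen _ (E.mul_mem hX (hUE u hu)))
    rwa [sub_mul, one_mul, ← mul_assoc, ← bX_add, add_neg_cancel, bX_zero, one_mul,
      sub_sub_cancel] at h
  have hall : ∀ w : FreeGroup (Fin 2), MonoidAlgebra.of K _ w ∈ leftStab U := by
    intro w
    induction w using FreeGroup.induction_on with
    | C1 => rw [map_one]; exact Subalgebra.one_mem _
    | of i =>
      fin_cases i
      · simpa [bX] using h0 1
      · simpa [bX] using h1'
    | inv_of i _ =>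
      fin_cases i
      · simpa [bX] using h0 (-1)
      · simpa [bX] using h1n
    | mul a b ha hb => rw [map_mul]; exact Subalgebra.mul_mem _ ha hb
  have hV : ∀ v : VB K, v ∈ leftStab U := by
    intro v
    induction v using MonoidAlgebra.induction_on with
    | of g => exact hall g
    | add a b ha hb => exact Subalgebra.add_mem _ ha hb
    | smul c a ha => exact Subalgebra.smul_mem _ ha c
  have hle : WB K ≤ E := leftSub_le E U hUE (by simpa using hgen 1 E.one_mem) hV
  refine AlgHom.ext fun w => ?_
  obtain ⟨w', hw', h⟩ := hle w.2
  have : w' = w := Subtype.ext h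
  exact this ▸ hw'

theorem exists_WB_hom {A : Type*} [Ring A] [Algebra K A] (y : ℤ → A) (z : A)
    (hz : (1 + y 0) * z = 1) (hz' : z * (1 + y 0) = 1) :
    ∃ f : WB K →ₐ[K] A, f (wX1inv K) = z ∧ ∀ n, f (wY K n) = y n := by
  obtain ⟨r, rs, rt⟩ : ∃ r : (Option ℤ →₀ Aᵐᵒᵖ) →ₗ[Aᵐᵒᵖ] Aᵐᵒᵖ,
      r (Finsupp.single none 1) = 1 ∧
      ∀ n, r (Finsupp.single (some n) 1) = MulOpposite.op (y n) :=
    ⟨Finsupp.linearCombination Aᵐᵒᵖ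
      (fun i : Option ℤ => i.elim (1 : Aᵐᵒᵖ) (fun n => MulOpposite.op (y n))),
      by simp, fun n => by simp⟩
  obtain ⟨sh, sh_none, sh_some⟩ :
      ∃ sh : ℤ → Module.End Aᵐᵒᵖ (Option ℤ →₀ Aᵐᵒᵖ),
        (∀ n, sh n (Finsupp.single none 1) = Finsupp.single none 1) ∧
        ∀ n k, sh n (Finsupp.single (some k) 1) = Finsupp.single (some (n + k)) 1 :=
    ⟨fun n => Finsupp.lmapDomain Aᵐᵒᵖ Aᵐᵒᵖ (Option.map (fun k => n + k)),
      fun n => by simp, fun n k => by simp⟩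
  have sh_add : ∀ m n, sh m * sh n = sh (m + n) := by
    intro m n
    refine Finsupp.lhom_ext' fun i => LinearMap.ext_ring ?_
    cases i <;> simp [sh_none, sh_some, add_assoc]
  have sh_zero : sh 0 = 1 := by
    refine Finsupp.lhom_ext' fun i => LinearMap.ext_ring ?_
    cases i <;> simp [sh_none, sh_some]
  obtain ⟨T, hT⟩ : ∃ T : Module.End Aᵐᵒᵖ (Option ℤ →₀ Aᵐᵒᵖ),
      ∀ m, T m = r m • Finsupp.single (some 0) 1 :=
    ⟨r.smulRight (Finsupp.single (some 0) 1), fun m => rfl⟩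
  obtain ⟨Q, hQ⟩ : ∃ Q : Module.End Aᵐᵒᵖ (Option ℤ →₀ Aᵐᵒᵖ),
      ∀ m, Q m = (r m * MulOpposite.op z) • Finsupp.single (some 0) 1 :=
    ⟨r.smulRight (MulOpposite.op z • Finsupp.single (some 0) 1), fun m => by
      rw [LinearMap.smulRight_apply, smul_smul]⟩
  have e1 : MulOpposite.op z * MulOpposite.op (y 0) = 1 - MulOpposite.op z := by
    rw [eq_sub_iff_add_eq, ← MulOpposite.op_mul, ← MulOpposite.op_add, ← MulOpposite.op_one, ← hz]
    congr 1
    noncomm_ring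
  have e2 : MulOpposite.op (y 0) * MulOpposite.op z = 1 - MulOpposite.op z := by
    rw [eq_sub_iff_add_eq, ← MulOpposite.op_mul, ← MulOpposite.op_add, ← MulOpposite.op_one, ← hz']
    congr 1
    noncomm_ring
  have hTQ : (1 + T) * (1 - Q) = 1 := by
    refine LinearMap.ext fun m => ?_
    simp only [Module.End.mul_apply, LinearMap.add_apply, LinearMap.sub_apply,
      Module.End.one_apply, hT, hQ, map_sub, map_smul, rt, smul_add, smul_smul, mul_assoc, e1,
      mul_sub, mul_one, sub_smul]
    abel
  have hQT : (1 - Q) * (1 + T) = 1 := by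
    refine LinearMap.ext fun m => ?_
    simp only [Module.End.mul_apply, LinearMap.add_apply, LinearMap.sub_apply,
      Module.End.one_apply, hT, hQ, map_add, map_smul, rt, e2, smul_sub, sub_smul, one_smul, smul_smul]
    abel
  obtain ⟨u0, hu0⟩ : ∃ u0 : (Module.End Aᵐᵒᵖ (Option ℤ →₀ Aᵐᵒᵖ))ˣ,
      ∀ n : ℤ, ((u0 ^ n : (Module.End Aᵐᵒᵖ (Option ℤ →₀ Aᵐᵒᵖ))ˣ) :
        Module.End Aᵐᵒᵖ (Option ℤ →₀ Aᵐᵒᵖ)) = sh n := by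
    refine ⟨⟨sh 1, sh (-1), by rw [sh_add]; exact sh_zero, by rw [sh_add]; exact sh_zero⟩, ?_⟩
    intro n
    induction n using Int.induction_on with
    | zero => rw [zpow_zero, sh_zero]; rfl
    | succ n ih => rw [zpow_add_one, Units.val_mul, ih, sh_add]
    | pred n ih => rw [zpow_sub_one, Units.val_mul, ih, Units.inv_mk, sh_add, sub_eq_add_neg]
  let u1 : (Module.End Aᵐᵒᵖ (Option ℤ →₀ Aᵐᵒᵖ))ˣ := ⟨1 + T, 1 - Q, hTQ, hQT⟩
  let ρ : VB K →ₐ[K] Module.End Aᵐᵒᵖ (Option ℤ →₀ Aᵐᵒᵖ) := MonoidAlgebra.lift K _ _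
    ((Units.coeHom _).comp (FreeGroup.lift ![u0, u1]))
  have hρ : ∀ i n, ρ (bX K i n) =
      ((![u0, u1] i ^ n : (Module.End Aᵐᵒᵖ (Option ℤ →₀ Aᵐᵒᵖ))ˣ) :
        Module.End Aᵐᵒᵖ (Option ℤ →₀ Aᵐᵒᵖ)) := by
    intro i n
    simp [ρ, bX]
  have hρ0 : ∀ n : ℤ, ρ (bX K 0 n) = sh n := fun n => (hρ 0 n).trans (hu0 n)
  have hρx : ρ (bX K 1 1 - 1) = T := by
    rw [map_sub, hρ, map_one, zpow_one]
    exact add_sub_cancel_left 1 T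
  have hρinv : ρ (bX K 1 (-1)) = 1 - Q := by
    rw [hρ, zpow_neg_one]
    rfl
  obtain ⟨f, hf⟩ := exists_algHom_leftSub ρ r (Finsupp.single none 1) rs (by
    intro m
    rw [hρx, hT, hT, rs, one_smul])
  refine ⟨f, ?_, fun n => ?_⟩
  · rw [hf]
    change (r (ρ (bX K 1 (-1)) _)).unop = _
    rw [hρinv, LinearMap.sub_apply, hQ, map_sub, map_smul, Module.End.one_apply, rs, rt, one_mul,
      smul_eq_mul, e1, sub_sub_cancel, MulOpposite.unop_op]
  · rw [hf]
    change (r (ρ (bX K 0 n * (bX K 1 1 - 1)) _)).unop = _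
    rw [map_mul, hρx, hρ0, Module.End.mul_apply, hT, rs, one_smul, sh_some, rt, add_zero,
      MulOpposite.unop_op]

variable (K)

theorem wY_zero : wX1inv K * (1 + wY K 0) = 1 ∧ (1 + wY K 0) * wX1inv K = 1 := by
  constructor
  · apply Subtype.ext
    change bX K 1 (-1) * (1 + bX K 0 0 * (bX K 1 1 - 1)) = 1
    rw [bX_zero, one_mul, add_sub_cancel, ← bX_add, neg_add_cancel, bX_zero]
  · apply Subtype.ext
    change (1 + bX K 0 0 * (bX K 1 1 - 1)) * bX K 1 (-1) = 1
    rw [bX_zero, one_mul, add_sub_cancel, ← bX_add, add_neg_cancel, bX_zero]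

theorem existsUnique_isBettiCoproduct : ∃! Δ, IsBettiCoproduct K Δ := by
  refine existsUnique_of_exists_of_unique ?_ fun f g hf hg => ?_
  case refine_2 =>
    refine WB_hom_ext (K := K) (A := WB K ⊗[K] WB K) ?_ ?_
    · exact hf.1.trans hg.1.symm
    · exact fun n => (hf.2 n).trans (hg.2 n).symm
  have h0 : (1 : WB K ⊗[K] WB K) + (wY K 0 ⊗ₜ 1 + 1 ⊗ₜ wY K 0
      - intSum 1 (0 - 1) (fun k => wY K k ⊗ₜ[K] wY K (0 - k))) =
      (1 + wY K 0) ⊗ₜ (1 + wY K 0) := by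
    simp only [intSum, TensorProduct.add_tmul, TensorProduct.tmul_add,
      Algebra.TensorProduct.one_def]
    norm_num
    abel
  obtain ⟨f, h1, h2⟩ := exists_WB_hom (K := K)
    (fun n => wY K n ⊗ₜ 1 + 1 ⊗ₜ wY K n
      - intSum 1 (n - 1) (fun k => wY K k ⊗ₜ[K] wY K (n - k)))
    (wX1inv K ⊗ₜ wX1inv K)
    (by rw [h0, Algebra.TensorProduct.tmul_mul_tmul, (wY_zero K).2]; rfl)
    (by rw [h0, Algebra.TensorProduct.tmul_mul_tmul, (wY_zero K).1]; rfl)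
  exact ⟨f, h1, h2⟩

/-- The Betti harmonic coproduct `Δ^{W,B} : W^B → W^B ⊗ W^B`: the algebra morphism such that
`X₁⁻¹ ↦ X₁⁻¹ ⊗ X₁⁻¹` and `X₀^n (X₁ - 1) ↦ X₀^n (X₁ - 1) ⊗ 1 + 1 ⊗ X₀^n (X₁ - 1)
- ∑_{k=1}^{n-1} X₀^k (X₁ - 1) ⊗ X₀^(n-k) (X₁ - 1)` for `n ∈ ℤ`. -/
noncomputable def deltaB : WB K →ₐ[K] WB K ⊗[K] WB K :=
  (existsUnique_isBettiCoproduct K).choose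

end Betti

/-! ### The filtrations relative to `F₂ → μ_N` -/

section BettiFiltration

/-- `ζ_N = exp(2πi/N)`, as an element of the group `μ_N` of complex `N`-th roots of unity. -/
noncomputable def zetaN (N : ℕ) [NeZero N] : rootsOfUnity N ℂ :=
  (Complex.isPrimitiveRoot_exp N (NeZero.ne N)).toRootsOfUnity

noncomputable instance (N : ℕ) [NeZero N] : Fintype (rootsOfUnity N ℂ) := Fintype.ofFinite _

/-- The group morphism `F₂ → μ_N`, `X₀ ↦ ζ_N`, `X₁ ↦ 1`. -/
noncomputable def toMu (N : ℕ) [NeZero N] : FreeGroup (Fin 2) →* rootsOfUnity N ℂ :=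
  FreeGroup.lift ![zetaN N, 1]

variable (K : Type*) [CommRing K] (N : ℕ) [NeZero N]

/-- The algebra morphism `K F₂ → K μ_N`. -/
noncomputable def algToMu : VB K →ₐ[K] MonoidAlgebra K (rootsOfUnity N ℂ) :=
  MonoidAlgebra.mapDomainAlgHom K K (toMu N)

/-- `I_N = ker(K F₂ → K μ_N)`. -/
noncomputable def idealI : Submodule K (VB K) := LinearMap.ker (algToMu K N).toLinearMap

variable {K N}

theorem idealI_mul_mem_left (v : VB K) {u : VB K} (hu : u ∈ idealI K N) : v * u ∈ idealI K N := by
  have h : algToMu K N u = 0 := hu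
  change algToMu K N (v * u) = 0
  rw [map_mul, h, mul_zero]

theorem idealI_mul_mem_right (v : VB K) {u : VB K} (hu : u ∈ idealI K N) :
    u * v ∈ idealI K N := by
  have h : algToMu K N u = 0 := hu
  change algToMu K N (u * v) = 0
  rw [map_mul, h, zero_mul]

theorem top_mul_idealI_pow (n : ℕ) : ⊤ * idealI K N ^ (n + 1) ≤ idealI K N ^ (n + 1) := by
  rw [pow_succ', ← mul_assoc]
  exact mul_le_mul_left (Submodule.mul_le.2 fun v _ u hu => idealI_mul_mem_left v hu) _

theorem idealI_pow_mul_top (n : ℕ) : idealI K N ^ (n + 1) * ⊤ ≤ idealI K N ^ (n + 1) := by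
  rw [pow_succ, mul_assoc]
  exact mul_le_mul_right (Submodule.mul_le.2 fun u hu v _ => idealI_mul_mem_right v hu) _

theorem idealI_pow_succ_le (n : ℕ) : idealI K N ^ (n + 1 + 1) ≤ idealI K N ^ (n + 1) :=
  calc idealI K N ^ (n + 1 + 1) = idealI K N ^ (n + 1) * idealI K N := pow_succ _ _
    _ ≤ idealI K N ^ (n + 1) * ⊤ := mul_le_mul_right le_top _
    _ ≤ _ := idealI_pow_mul_top n

theorem idealI_pow_anti {m n : ℕ} (hm : 0 < m) (h : m ≤ n) : idealI K N ^ n ≤ idealI K N ^ m := by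
  obtain ⟨m, rfl⟩ := Nat.exists_eq_succ_of_ne_zero hm.ne'
  induction n, h using Nat.le_induction with
  | base => exact le_rfl
  | succ n hn ih =>
    obtain ⟨n, rfl⟩ := Nat.exists_eq_succ_of_ne_zero (show n ≠ 0 by omega)
    exact (idealI_pow_succ_le n).trans ih

variable (K N)

/-- `F^m V^B_N`: `K F₂` for `m ≤ 0`, and `I_N^m` for `m > 0`. -/
noncomputable def filVB (m : ℤ) : Submodule K (VB K) :=
  if m ≤ 0 then ⊤ else idealI K N ^ m.toNat

variable {K N}

theorem filVB_of_nonpos {m : ℤ} (h : m ≤ 0) : filVB K N m = ⊤ := if_pos h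

theorem filVB_of_pos {m : ℤ} (h : 0 < m) : filVB K N m = idealI K N ^ m.toNat :=
  if_neg (not_le.2 h)

theorem filVB_anti : Antitone (filVB K N) := by
  intro m n h
  rcases le_or_gt m 0 with hm | hm
  · rw [filVB_of_nonpos hm]; exact le_top
  · rw [filVB_of_pos hm, filVB_of_pos (hm.trans_le h)]
    exact idealI_pow_anti (by omega) (by omega)

theorem filVB_mul_le (i j : ℤ) : filVB K N i * filVB K N j ≤ filVB K N (i + j) := by
  rcases le_or_gt i 0 with hi | hi
  · rcases le_or_gt j 0 with hj | hj
    · rw [filVB_of_nonpos (show i + j ≤ 0 by omega)]; exact le_top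
    · refine le_trans ?_ (filVB_anti (show i + j ≤ j by omega))
      rw [filVB_of_nonpos hi, filVB_of_pos hj]
      obtain ⟨n, hn⟩ := Nat.exists_eq_succ_of_ne_zero (show j.toNat ≠ 0 by omega)
      rw [hn]
      exact top_mul_idealI_pow n
  · rcases le_or_gt j 0 with hj | hj
    · refine le_trans ?_ (filVB_anti (show i + j ≤ i by omega))
      rw [filVB_of_nonpos hj, filVB_of_pos hi]
      obtain ⟨n, hn⟩ := Nat.exists_eq_succ_of_ne_zero (show i.toNat ≠ 0 by omega)
      rw [hn]
      exact idealI_pow_mul_top n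
    · rw [filVB_of_pos hi, filVB_of_pos hj, filVB_of_pos (by omega), ← pow_add,
        show i.toNat + j.toNat = (i + j).toNat by omega]

variable (K N)

/-- The filtered algebra `V^B_N`. -/
noncomputable def filtVB : AlgFiltration K (VB K) where
  F := filVB K N
  anti := filVB_anti
  one_mem := by rw [filVB_of_nonpos le_rfl]; trivial
  mul_mem ha hb := filVB_mul_le _ _ (Submodule.mul_mem_mul ha hb)

/-- The filtered algebra `W^B_N`, with `F^m W^B_N = W^B_N ∩ F^m V^B_N`. -/
noncomputable def filtWB : AlgFiltration K (WB K) := (filtVB K N).restrict (WB K)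

end BettiFiltration

/-! ### The de Rham side -/

section DeRham

/-- The generators `e₀`, `e₁` and `ζ ∈ μ_N`. -/
inductive DRGen (N : ℕ) : Type
  | e0 : DRGen N
  | e1 : DRGen N
  | root (ζ : rootsOfUnity N ℂ) : DRGen N

/-- The degrees of the generators. -/
def DRGen.deg {N : ℕ} : DRGen N → ℕ
  | .e0 => 1
  | .e1 => 1
  | .root _ => 0

/-- The defining relations of `V^DR_N`. -/
inductive DRRel (K : Type*) [CommRing K] (N : ℕ) :
    FreeAlgebra K (DRGen N) → FreeAlgebra K (DRGen N) → Prop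
  | mul (ζ η : rootsOfUnity N ℂ) : DRRel K N
      (FreeAlgebra.ι K (.root ζ) * FreeAlgebra.ι K (.root η)) (FreeAlgebra.ι K (.root (ζ * η)))
  | one : DRRel K N (FreeAlgebra.ι K (.root 1)) 1
  | comm (ζ : rootsOfUnity N ℂ) : DRRel K N
      (FreeAlgebra.ι K (.root ζ) * FreeAlgebra.ι K .e0)
      (FreeAlgebra.ι K .e0 * FreeAlgebra.ι K (.root ζ))

variable (K : Type*) [CommRing K] (N : ℕ)

/-- The algebra `V^DR_N`. -/
def VDR : Type _ := RingQuot (DRRel K N)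

noncomputable instance : Ring (VDR K N) := inferInstanceAs (Ring (RingQuot (DRRel K N)))

noncomputable instance : Algebra K (VDR K N) :=
  inferInstanceAs (Algebra K (RingQuot (DRRel K N)))

/-- The quotient morphism from the free algebra to `V^DR_N`. -/
noncomputable def mkVDR : FreeAlgebra K (DRGen N) →ₐ[K] VDR K N :=
  RingQuot.mkAlgHom K (DRRel K N)

theorem mkVDR_rel {a b : FreeAlgebra K (DRGen N)} (h : DRRel K N a b) :
    mkVDR K N a = mkVDR K N b := RingQuot.mkAlgHom_rel K h

theorem mkVDR_surjective : Function.Surjective (mkVDR K N) :=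
  RingQuot.mkAlgHom_surjective K (DRRel K N)

/-- The image of a generator in `V^DR_N`. -/
noncomputable def drι (g : DRGen N) : VDR K N :=
  mkVDR K N (FreeAlgebra.ι K g)

/-- The degree `n` part of `V^DR_N`, spanned by the words of degree `n` in the generators. -/
noncomputable def degVDR (n : ℕ) : Submodule K (VDR K N) :=
  Submodule.span K {v | ∃ l : List (DRGen N), (l.map DRGen.deg).sum = n ∧
    v = (l.map (drι K N)).prod}

/-- `W^DR_N = K ⊕ V^DR_N e₁`. -/
noncomputable abbrev WDR : Subalgebra K (VDR K N) := leftSub K (drι K N .e1)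

/-- `z_{n,ζ} = - e₀^(n-1) ζ e₁ ∈ W^DR_N`, for `n ≥ 1`. -/
noncomputable def drZ (n : ℕ) (ζ : rootsOfUnity N ℂ) : WDR K N :=
  ⟨-(drι K N .e0 ^ (n - 1) * drι K N (.root ζ)) * drι K N .e1, mul_mem_leftSub _ _⟩

variable {K N}

theorem drι_mul (ζ η : rootsOfUnity N ℂ) :
    drι K N (.root ζ) * drι K N (.root η) = drι K N (.root (ζ * η)) := by
  unfold drι
  rw [← map_mul]
  exact mkVDR_rel K N (DRRel.mul ζ η)

theorem drι_one : drι K N (.root 1) = 1 := by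
  unfold drι
  rw [mkVDR_rel K N DRRel.one, map_one]

theorem drι_comm (ζ : rootsOfUnity N ℂ) :
    drι K N (.root ζ) * drι K N .e0 = drι K N .e0 * drι K N (.root ζ) := by
  unfold drι
  rw [← map_mul, ← map_mul]
  exact mkVDR_rel K N (DRRel.comm ζ)

/-- The universal property of `V^DR_N`. -/
noncomputable def liftVDR {A : Type*} [Ring A] [Algebra K A] (g : DRGen N → A)
    (hmul : ∀ ζ η, g (.root ζ) * g (.root η) = g (.root (ζ * η)))
    (hone : g (.root 1) = 1) (hcomm : ∀ ζ, g (.root ζ) * g .e0 = g .e0 * g (.root ζ)) :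
    VDR K N →ₐ[K] A :=
  RingQuot.liftAlgHom K ⟨FreeAlgebra.lift K g, by
    rintro _ _ (⟨ζ, η⟩ | _ | ζ)
    · simpa using hmul ζ η
    · simpa using hone
    · simpa using hcomm ζ⟩

theorem liftVDR_ι {A : Type*} [Ring A] [Algebra K A] (g : DRGen N → A)
    (hmul : ∀ ζ η, g (.root ζ) * g (.root η) = g (.root (ζ * η)))
    (hone : g (.root 1) = 1) (hcomm : ∀ ζ, g (.root ζ) * g .e0 = g .e0 * g (.root ζ))
    (x : DRGen N) : liftVDR (K := K) g hmul hone hcomm (drι K N x) = g x := by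
  exact (RingQuot.liftAlgHom_mkAlgHom_apply K (s := DRRel K N) _ _ _).trans
    (FreeAlgebra.lift_ι_apply g x)

theorem VDR_mem_of_gen (E : Subalgebra K (VDR K N)) (h : ∀ g, drι K N g ∈ E) (v : VDR K N) :
    v ∈ E := by
  obtain ⟨a, rfl⟩ := mkVDR_surjective K N v
  induction a using FreeAlgebra.induction with
  | grade0 c => rw [AlgHom.commutes]; exact E.algebraMap_mem c
  | grade1 g => exact h g
  | mul a b ha hb => rw [map_mul]; exact E.mul_mem ha hb
  | add a b ha hb => rw [map_add]; exact E.add_mem ha hb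

theorem WDR_hom_ext {A : Type*} [Ring A] [Algebra K A] {f g : WDR K N →ₐ[K] A}
    (h : ∀ n ζ, 1 ≤ n → f (drZ K N n ζ) = g (drZ K N n ζ)) : f = g := by
  let E : Subalgebra K (VDR K N) := (AlgHom.equalizer f g).map (WDR K N).val
  have hZ : ∀ n ζ, drι K N .e0 ^ n * drι K N (.root ζ) * drι K N .e1 ∈ E := by
    intro n ζ
    have h1 : -(drι K N .e0 ^ n * drι K N (.root ζ)) * drι K N .e1 ∈ E :=
      ⟨drZ K N (n + 1) ζ, h (n + 1) ζ (by omega), rfl⟩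
    rw [neg_mul] at h1
    simpa using E.neg_mem h1
  let U : Submodule K (VDR K N) := Submodule.span K
    {u | ∃ (n : ℕ) (ζ : rootsOfUnity N ℂ) (e : VDR K N), e ∈ E ∧
      u = drι K N .e0 ^ n * drι K N (.root ζ) * drι K N .e1 * e}
  have hUE : ∀ u ∈ U, u ∈ E := by
    intro u hu
    have : U ≤ Subalgebra.toSubmodule E := by
      refine Submodule.span_le.2 ?_
      rintro _ ⟨n, ζ, e, he, rfl⟩
      exact E.mul_mem (hZ n ζ) he
    exact this hu
  have hgen : ∀ e ∈ E, drι K N .e1 * e ∈ U := fun e he =>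
    Submodule.subset_span ⟨0, 1, e, he, by rw [pow_zero, drι_one, one_mul, one_mul]⟩
  have hstab : ∀ v : VDR K N, (∀ n ζ, ∀ e ∈ E,
      v * (drι K N .e0 ^ n * drι K N (.root ζ) * drι K N .e1 * e) ∈ U) → v ∈ leftStab U := by
    intro v hv u hu
    refine Submodule.span_induction (p := fun u _ => v * u ∈ U) ?_ (by simp)
      (fun a b _ _ ha hb => by rw [mul_add]; exact U.add_mem ha hb)
      (fun c a _ ha => by rw [mul_smul_comm]; exact U.smul_mem c ha) hu
    rintro _ ⟨m, ζ, e, he, rfl⟩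
    exact hv m ζ e he
  have hV : ∀ v, v ∈ leftStab U := by
    refine VDR_mem_of_gen _ ?_
    rintro (_ | _ | η)
    · refine hstab _ fun n ζ e he => Submodule.subset_span ⟨n + 1, ζ, e, he, ?_⟩
      rw [pow_succ']
      simp only [mul_assoc]
    · exact fun u hu => hgen u (hUE u hu)
    · refine hstab _ fun n ζ e he => Submodule.subset_span ⟨n, η * ζ, e, he, ?_⟩
      have hc : drι K N (.root η) * drι K N .e0 ^ n = drι K N .e0 ^ n * drι K N (.root η) :=
        Commute.pow_right (drι_comm η) n
      rw [← drι_mul]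
      simp only [← mul_assoc]
      rw [hc]
  have hle : WDR K N ≤ E := leftSub_le E U hUE (by simpa using hgen 1 E.one_mem) hV
  refine AlgHom.ext fun w => ?_
  obtain ⟨w', hw', h⟩ := hle w.2
  have : w' = w := Subtype.ext h
  exact this ▸ hw'

theorem exists_WDR_hom {A : Type*} [Ring A] [Algebra K A] (z : ℕ → rootsOfUnity N ℂ → A) :
    ∃ f : WDR K N →ₐ[K] A, ∀ n ζ, 1 ≤ n → f (drZ K N n ζ) = z n ζ := by
  obtain ⟨r, rs, rt⟩ : ∃ r : (Option (ℕ × rootsOfUnity N ℂ) →₀ Aᵐᵒᵖ) →ₗ[Aᵐᵒᵖ] Aᵐᵒᵖ,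
      r (Finsupp.single none 1) = 1 ∧
      ∀ n ζ, r (Finsupp.single (some (n, ζ)) 1) = -MulOpposite.op (z (n + 1) ζ) :=
    ⟨Finsupp.linearCombination Aᵐᵒᵖ
      (fun i : Option (ℕ × rootsOfUnity N ℂ) =>
        i.elim (1 : Aᵐᵒᵖ) (fun p => -MulOpposite.op (z (p.1 + 1) p.2))),
      by simp, fun n ζ => by simp⟩
  obtain ⟨g0, g0_none, g0_some⟩ :
      ∃ g0 : Module.End Aᵐᵒᵖ (Option (ℕ × rootsOfUnity N ℂ) →₀ Aᵐᵒᵖ),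
        g0 (Finsupp.single none 1) = Finsupp.single none 1 ∧
        ∀ n ζ, g0 (Finsupp.single (some (n, ζ)) 1) = Finsupp.single (some (n + 1, ζ)) 1 :=
    ⟨Finsupp.lmapDomain Aᵐᵒᵖ Aᵐᵒᵖ (Option.map (fun p => (p.1 + 1, p.2))),
      by simp, fun n ζ => by simp⟩
  obtain ⟨gr, gr_none, gr_some⟩ :
      ∃ gr : rootsOfUnity N ℂ → Module.End Aᵐᵒᵖ (Option (ℕ × rootsOfUnity N ℂ) →₀ Aᵐᵒᵖ),
        (∀ η, gr η (Finsupp.single none 1) = Finsupp.single none 1) ∧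
        ∀ η n ζ, gr η (Finsupp.single (some (n, ζ)) 1) = Finsupp.single (some (n, η * ζ)) 1 :=
    ⟨fun η => Finsupp.lmapDomain Aᵐᵒᵖ Aᵐᵒᵖ (Option.map (fun p => (p.1, η * p.2))),
      fun η => by simp, fun η n ζ => by simp⟩
  obtain ⟨T, hT⟩ : ∃ T : Module.End Aᵐᵒᵖ (Option (ℕ × rootsOfUnity N ℂ) →₀ Aᵐᵒᵖ),
      ∀ m, T m = r m • Finsupp.single (some (0, 1)) 1 :=
    ⟨r.smulRight (Finsupp.single (some (0, 1)) 1), fun m => rfl⟩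
  let g : DRGen N → Module.End Aᵐᵒᵖ (Option (ℕ × rootsOfUnity N ℂ) →₀ Aᵐᵒᵖ)
    | .e0 => g0
    | .e1 => T
    | .root ζ => gr ζ
  have hmul : ∀ ζ η, g (.root ζ) * g (.root η) = g (.root (ζ * η)) := by
    intro ζ η
    change gr ζ * gr η = gr (ζ * η)
    refine Finsupp.lhom_ext' fun i => LinearMap.ext_ring ?_
    rcases i with _ | ⟨n, ξ⟩ <;> simp [gr_none, gr_some, mul_assoc]
  have hone : g (.root 1) = 1 := by
    change gr 1 = 1
    refine Finsupp.lhom_ext' fun i => LinearMap.ext_ring ?_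
    rcases i with _ | ⟨n, ξ⟩ <;> simp [gr_none, gr_some]
  have hcomm : ∀ ζ, g (.root ζ) * g .e0 = g .e0 * g (.root ζ) := by
    intro ζ
    change gr ζ * g0 = g0 * gr ζ
    refine Finsupp.lhom_ext' fun i => LinearMap.ext_ring ?_
    rcases i with _ | ⟨n, ξ⟩ <;> simp [gr_none, gr_some, g0_none, g0_some]
  let ρ : VDR K N →ₐ[K] Module.End Aᵐᵒᵖ (Option (ℕ × rootsOfUnity N ℂ) →₀ Aᵐᵒᵖ) :=
    liftVDR g hmul hone hcomm
  have hρ1 : ρ (drι K N .e1) = T := liftVDR_ι g hmul hone hcomm .e1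
  have hρ0 : ρ (drι K N .e0) = g0 := liftVDR_ι g hmul hone hcomm .e0
  have hρr : ∀ ζ, ρ (drι K N (.root ζ)) = gr ζ := fun ζ => liftVDR_ι g hmul hone hcomm (.root ζ)
  have g0_pow : ∀ n ζ, (g0 ^ n) (Finsupp.single (some (0, ζ)) 1) =
      Finsupp.single (some (n, ζ)) 1 := by
    intro n ζ
    induction n with
    | zero => simp
    | succ n ih => rw [pow_succ', Module.End.mul_apply, ih, g0_some]
  obtain ⟨f, hf⟩ := exists_algHom_leftSub ρ r (Finsupp.single none 1) rs (by
    intro m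
    rw [hρ1, hT, hT, rs, one_smul])
  refine ⟨f, fun n ζ hn => ?_⟩
  rw [hf]
  change (r (ρ (-(drι K N .e0 ^ (n - 1) * drι K N (.root ζ)) * drι K N .e1) _)).unop = _
  rw [map_mul, map_neg, map_mul, map_pow, hρ0, hρ1, hρr, Module.End.mul_apply, hT, rs, one_smul,
    LinearMap.neg_apply, Module.End.mul_apply, gr_some, g0_pow, map_neg, rt, mul_one,
    Nat.sub_add_cancel hn, neg_neg, MulOpposite.unop_op]

variable (K N) [NeZero N]

/-- The formulas that characterise the de Rham harmonic coproduct. -/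
def IsDeRhamCoproduct (Δ : WDR K N →ₐ[K] WDR K N ⊗[K] WDR K N) : Prop :=
  ∀ (n : ℕ) (ζ : rootsOfUnity N ℂ), 1 ≤ n →
    Δ (drZ K N n ζ) = drZ K N n ζ ⊗ₜ 1 + 1 ⊗ₜ drZ K N n ζ +
      ∑ k ∈ Finset.Icc 1 (n - 1), ∑ η : rootsOfUnity N ℂ,
        drZ K N k η ⊗ₜ[K] drZ K N (n - k) (ζ * η⁻¹)

theorem existsUnique_isDeRhamCoproduct : ∃! Δ, IsDeRhamCoproduct K N Δ := by
  refine existsUnique_of_exists_of_unique ?_ fun f g hf hg => ?_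
  · exact exists_WDR_hom (K := K) (A := WDR K N ⊗[K] WDR K N) _
  · exact WDR_hom_ext (K := K) (A := WDR K N ⊗[K] WDR K N)
      fun n ζ hn => (hf n ζ hn).trans (hg n ζ hn).symm

/-- The de Rham cyclotomic harmonic coproduct `Δ^{W,DR}_N`: the algebra morphism such that
`z_{n,ζ} ↦ z_{n,ζ} ⊗ 1 + 1 ⊗ z_{n,ζ} + ∑_{k=1}^{n-1} ∑_{η ∈ μ_N} z_{k,η} ⊗ z_{n-k,ζη⁻¹}`. -/
noncomputable def deltaDR : WDR K N →ₐ[K] WDR K N ⊗[K] WDR K N :=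
  (existsUnique_isDeRhamCoproduct K N).choose

end DeRham

/-! ### The comparison of `V^DR_N`, `W^DR_N` with `gr(V^B_N)`, `gr(W^B_N)` -/

section Rho

variable (K : Type*) [CommRing K] (N : ℕ) [NeZero N]

theorem filtVB_zero (v : VB K) : v ∈ (filtVB K N).F 0 := by
  change v ∈ filVB K N 0
  rw [filVB_of_nonpos le_rfl]
  trivial

theorem mem_filtVB_one {v : VB K} (h : v ∈ idealI K N) : v ∈ (filtVB K N).F 1 := by
  change v ∈ filVB K N 1
  rw [filVB_of_pos one_pos]
  simpa using h

theorem zetaN_pow : zetaN N ^ N = 1 := by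
  apply Subtype.ext
  exact (zetaN N).2

theorem zetaN_orderOf : orderOf (zetaN N) = N := by
  have h := (Complex.isPrimitiveRoot_exp N (NeZero.ne N)).eq_orderOf
  rw [← Subgroup.orderOf_coe, ← orderOf_units]
  exact h.symm

theorem mem_zpowers_zetaN (ζ : rootsOfUnity N ℂ) : ζ ∈ Subgroup.zpowers (zetaN N) := by
  have h : IsPrimitiveRoot ((zetaN N : rootsOfUnity N ℂ) : ℂˣ) N :=
    IsPrimitiveRoot.coe_units_iff.1 (Complex.isPrimitiveRoot_exp N (NeZero.ne N))
  have h2 : (ζ : ℂˣ) ∈ Subgroup.zpowers ((zetaN N : rootsOfUnity N ℂ) : ℂˣ) := by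
    rw [h.zpowers_eq]
    exact ζ.2
  obtain ⟨k, hk⟩ := h2
  exact ⟨k, Subtype.ext hk⟩

theorem bX_zero_N_sub_one_mem : bX K 0 N - 1 ∈ idealI K N := by
  change algToMu K N (bX K 0 N - 1) = 0
  rw [map_sub, map_one, sub_eq_zero]
  have h : toMu N (FreeGroup.of 0 ^ (N : ℤ)) = 1 := by
    rw [map_zpow, zpow_natCast]
    simp [toMu, zetaN_pow]
  simp only [algToMu, bX, MonoidAlgebra.of_apply, MonoidAlgebra.mapDomainAlgHom_apply,
    MonoidAlgebra.mapDomain_single]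
  rw [h]
  rfl

theorem bX_one_one_sub_one_mem : bX K 1 1 - 1 ∈ idealI K N := by
  change algToMu K N (bX K 1 1 - 1) = 0
  rw [map_sub, map_one, sub_eq_zero]
  have h : toMu N (FreeGroup.of 1 ^ (1 : ℤ)) = 1 := by
    simp [toMu]
  simp only [algToMu, bX, MonoidAlgebra.of_apply, MonoidAlgebra.mapDomainAlgHom_apply,
    MonoidAlgebra.mapDomain_single]
  rw [h]
  rfl

/-- The class `[X₀]₀`, as a unit of `gr(V^B_N)`. -/
noncomputable def clsX0 : ((filtVB K N).Gr)ˣ where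
  val := (filtVB K N).cls 0 (bX K 0 1) (filtVB_zero K N _)
  inv := (filtVB K N).cls 0 (bX K 0 (-1)) (filtVB_zero K N _)
  val_inv := by
    rw [AlgFiltration.cls_mul, ← AlgFiltration.cls_one]
    exact AlgFiltration.cls_congr _ rfl (by rw [← bX_add, add_neg_cancel, bX_zero]) _ _
  inv_val := by
    rw [AlgFiltration.cls_mul, ← AlgFiltration.cls_one]
    exact AlgFiltration.cls_congr _ rfl (by rw [← bX_add, neg_add_cancel, bX_zero]) _ _

theorem clsX0_pow_val (n : ℕ) : ((clsX0 K N ^ n : ((filtVB K N).Gr)ˣ) : (filtVB K N).Gr) =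
    (filtVB K N).cls 0 (bX K 0 n) (filtVB_zero K N _) := by
  induction n with
  | zero =>
    rw [pow_zero, Units.val_one, ← AlgFiltration.cls_one]
    exact AlgFiltration.cls_congr _ rfl (bX_zero K 0).symm _ _
  | succ n ih =>
    rw [pow_succ, Units.val_mul, ih]
    change (filtVB K N).cls 0 _ _ * (filtVB K N).cls 0 _ _ = _
    rw [AlgFiltration.cls_mul]
    exact AlgFiltration.cls_congr _ rfl (by rw [← bX_add]; push_cast; rfl) _ _

theorem clsX0_pow : clsX0 K N ^ N = 1 := by
  apply Units.ext
  rw [clsX0_pow_val, Units.val_one, ← AlgFiltration.cls_one]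
  refine AlgFiltration.cls_sub_eq _ _ _ ?_
  exact mem_filtVB_one K N (bX_zero_N_sub_one_mem K N)

/-- The group morphism `μ_N → gr(V^B_N)ˣ`, `ζ_N ↦ [X₀]₀`. -/
noncomputable def muToGr : rootsOfUnity N ℂ →* ((filtVB K N).Gr)ˣ :=
  monoidHomOfForallMemZpowers (mem_zpowers_zetaN N) (g' := clsX0 K N) (by
    rw [zetaN_orderOf]
    exact orderOf_dvd_of_pow_eq_one (clsX0_pow K N))

theorem muToGr_zetaN : muToGr K N (zetaN N) = clsX0 K N :=
  monoidHomOfForallMemZpowers_apply_gen _ _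

/-- The images of the generators under `ρ^V_N`. -/
noncomputable def rhoGen : DRGen N → (filtVB K N).Gr
  | .e0 => (filtVB K N).cls 1 (bX K 0 N - 1) (mem_filtVB_one K N (bX_zero_N_sub_one_mem K N))
  | .e1 => (filtVB K N).cls 1 (bX K 1 1 - 1) (mem_filtVB_one K N (bX_one_one_sub_one_mem K N))
  | .root ζ => muToGr K N ζ

theorem commute_clsX0 : Commute ((clsX0 K N : ((filtVB K N).Gr)ˣ) : (filtVB K N).Gr)
    (rhoGen K N .e0) := by
  change (filtVB K N).cls 0 _ _ * (filtVB K N).cls 1 _ _ =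
    (filtVB K N).cls 1 _ _ * (filtVB K N).cls 0 _ _
  rw [AlgFiltration.cls_mul, AlgFiltration.cls_mul]
  refine AlgFiltration.cls_congr _ (by norm_num) ?_ _ _
  rw [mul_sub, sub_mul, ← bX_add, ← bX_add, add_comm, mul_one, one_mul]

/-- The graded algebra morphism `ρ^V_N : V^DR_N → gr(V^B_N)`,
`ζ_N ↦ [X₀]₀`, `e₀ ↦ [X₀^N - 1]₁`, `e₁ ↦ [X₁ - 1]₁`. -/
noncomputable def rhoV : VDR K N →ₐ[K] (filtVB K N).Gr :=
  liftVDR (rhoGen K N)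
    (fun ζ η => by
      change (muToGr K N ζ : (filtVB K N).Gr) * muToGr K N η = muToGr K N (ζ * η)
      rw [map_mul, Units.val_mul])
    (by
      change ((muToGr K N 1 : ((filtVB K N).Gr)ˣ) : (filtVB K N).Gr) = 1
      rw [map_one, Units.val_one])
    (fun ζ => by
      obtain ⟨k, rfl⟩ := mem_zpowers_zetaN N ζ
      change ((muToGr K N (zetaN N ^ k) : ((filtVB K N).Gr)ˣ) : (filtVB K N).Gr) *
        rhoGen K N .e0 = rhoGen K N .e0 * (muToGr K N (zetaN N ^ k) : ((filtVB K N).Gr)ˣ)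
      rw [map_zpow, muToGr_zetaN]
      exact (commute_clsX0 K N).units_zpow_left k)

/-- The morphism `gr(W^B_N) → gr(V^B_N)` induced by the inclusion. -/
noncomputable def grIncl : (filtWB K N).Gr →ₐ[K] (filtVB K N).Gr :=
  AlgFiltration.grMap (WB K).val (AlgFiltration.isFiltered_val (filtVB K N) (WB K))

theorem grIncl_injective : Function.Injective (grIncl K N) :=
  AlgFiltration.grMap_val_injective (filtVB K N) (WB K)

theorem rhoV_mem_range (w : WDR K N) : rhoV K N w ∈ (grIncl K N).range := by
  obtain ⟨_, c, v, rfl⟩ := w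
  change rhoV K N (algebraMap K _ c + v * drι K N .e1) ∈ _
  rw [map_add, AlgHom.commutes, map_mul]
  refine Subalgebra.add_mem _ (Subalgebra.algebraMap_mem _ c) ?_
  rw [show rhoV K N (drι K N .e1) = rhoGen K N .e1 from liftVDR_ι _ _ _ _ _]
  generalize rhoV K N v = x
  induction x using AlgFiltration.gr_induction with
  | h0 => rw [zero_mul]; exact Subalgebra.zero_mem _
  | hadd x y hx hy => rw [add_mul]; exact Subalgebra.add_mem _ hx hy
  | hcls i a ha =>
    have h := (filtVB K N).mul_mem ha (mem_filtVB_one K N (bX_one_one_sub_one_mem K N))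
    refine ⟨(filtWB K N).cls (i + 1) ⟨a * (bX K 1 1 - 1), mul_mem_leftSub _ _⟩ h, ?_⟩
    change grIncl K N ((filtWB K N).cls _ _ _) = (filtVB K N).cls i a ha * (filtVB K N).cls 1 _ _
    rw [AlgFiltration.cls_mul]
    exact AlgFiltration.grMap_cls _ _ _

/-- The morphism `ρ^W_N : W^DR_N → gr(W^B_N)` induced by `ρ^V_N`. -/
noncomputable def rhoW : WDR K N →ₐ[K] (filtWB K N).Gr :=
  (AlgEquiv.ofInjective (grIncl K N) (grIncl_injective K N)).symm.toAlgHom.comp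
    (((rhoV K N).comp (WDR K N).val).codRestrict (grIncl K N).range (rhoV_mem_range K N))

theorem grIncl_rhoW (w : WDR K N) : grIncl K N (rhoW K N w) = rhoV K N w :=
  congrArg Subtype.val ((AlgEquiv.ofInjective (grIncl K N) (grIncl_injective K N)).apply_symm_apply
    ⟨rhoV K N w, rhoV_mem_range K N w⟩)

/-- The associated graded morphism `gr(Δ^{W,B}) : gr(W^B_N) → gr(W^B_N) ⊗ gr(W^B_N)`, that is
`gr(W^B_N) → gr(W^B_N ⊗ W^B_N)` followed by the inverse of the canonical morphism
`gr(W^B_N) ⊗ gr(W^B_N) → gr(W^B_N ⊗ W^B_N)`; it is defined as soon as `Δ^{W,B}` is filtered and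
the canonical morphism is bijective. -/
noncomputable def grDeltaB
    (hΔ : AlgFiltration.IsFiltered (filtWB K N) ((filtWB K N).tensor (filtWB K N)) (deltaB K))
    (hcan : Function.Bijective (AlgFiltration.grTensor (filtWB K N) (filtWB K N))) :
    (filtWB K N).Gr →ₐ[K] (filtWB K N).Gr ⊗[K] (filtWB K N).Gr :=
  (AlgEquiv.ofBijective (AlgFiltration.grTensor (filtWB K N) (filtWB K N)) hcan).symm.toAlgHom.comp
    (AlgFiltration.grMap (deltaB K) hΔ)

end Rho

/-!
The expansion of `K F₂` in power series `X` with coefficients in the `μ_N × μ_N` matrices over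
`V^DR_N`, given by `X₀ ↦ ζ_N (1 + E X)` and `X₁ ↦ 1 + e₁ X`, where `ζ_N` acts by the regular
representation and `E` is diagonal with single nonzero entry `e₀`, satisfies `X₀^N ↦ 1 + e₀ X` to
first order. It therefore maps `I_N^m` to series of order at least `m`, and taking leading
coefficients inverts `ρ^V_N` on the left. Surjectivity of `ρ^V_N` holds because `X₀^N - 1` and
`X₁ - 1` generate `I_N`. As `e₁` is not a right zero divisor of `V^DR_N`, right multiplication by
`X₁ - 1` is strict for the filtrations, which gives the statement for `ρ^W_N`.

The leading coefficients are defined on all of `W^B_N`, not only on the steps of the filtration, so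
that they can be tensored: this shows that `gr` commutes with `⊗`, without any flatness of the
graded pieces.

For the coproducts, `Δ^{W,B}((X₀^N - 1)^m X₀^a (X₁ - 1))` has a closed form, whose terms of lowest
degree are those of `Δ^{W,DR}_N(e₀^m ζ_N^a e₁)`. To deduce that `Δ^{W,B}` is filtered on all of
`W^B_N`, one uses left ideals of `K F₂` contained in `W^B_N` on which `Δ^{W,B}` is filtered and on
which multiplication by `I_N` raises the degree by one.
-/

/-! ### Filtrations and associated graded algebras -/

namespace AlgFiltration

section ClassArithmetic

variable {K A : Type*} [CommRing K] [Ring A] [Algebra K A] (𝓕 : AlgFiltration K A)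

/-- The class map `a ↦ [a]_i` as a linear map on `F^i`. -/
noncomputable def clsHom (i : ℤ) : 𝓕.F i →ₗ[K] 𝓕.Gr :=
  DirectSum.lof K ℤ 𝓕.Piece i ∘ₗ 𝓕.proj i

theorem cls_add {i : ℤ} {a b : A} (ha : a ∈ 𝓕.F i) (hb : b ∈ 𝓕.F i) :
    𝓕.cls i (a + b) (Submodule.add_mem _ ha hb) = 𝓕.cls i a ha + 𝓕.cls i b hb :=
  map_add (𝓕.clsHom i) ⟨a, ha⟩ ⟨b, hb⟩

theorem cls_sub {i : ℤ} {a b : A} (ha : a ∈ 𝓕.F i) (hb : b ∈ 𝓕.F i) :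
    𝓕.cls i (a - b) (Submodule.sub_mem _ ha hb) = 𝓕.cls i a ha - 𝓕.cls i b hb :=
  map_sub (𝓕.clsHom i) ⟨a, ha⟩ ⟨b, hb⟩

theorem cls_eq_zero_iff {i : ℤ} {a : A} (ha : a ∈ 𝓕.F i) :
    𝓕.cls i a ha = 0 ↔ a ∈ 𝓕.F (i + 1) :=
  (map_eq_zero_iff _ (DirectSum.of_injective (β := 𝓕.Piece) i)).trans (𝓕.proj_eq_zero_iff _)

theorem cls_algebraMap (c : K) (h : algebraMap K A c ∈ 𝓕.F 0) :
    𝓕.cls 0 (algebraMap K A c) h = algebraMap K 𝓕.Gr c := by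
  rw [Algebra.algebraMap_eq_smul_one (A := 𝓕.Gr), ← cls_one]
  exact (𝓕.cls_congr rfl (Algebra.algebraMap_eq_smul_one c) _ _).trans
    (map_smul (𝓕.clsHom 0) c ⟨1, 𝓕.one_mem⟩)

/-- The element `a` belongs to `F^i` and its class in `gr(A)` is `x`. -/
def HasCls (i : ℤ) (a : A) (x : 𝓕.Gr) : Prop := ∃ h : a ∈ 𝓕.F i, 𝓕.cls i a h = x

variable {𝓕}

theorem HasCls.add {i : ℤ} {a b : A} {x y : 𝓕.Gr} (ha : 𝓕.HasCls i a x) (hb : 𝓕.HasCls i b y) :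
    𝓕.HasCls i (a + b) (x + y) := by
  obtain ⟨ha, rfl⟩ := ha
  obtain ⟨hb, rfl⟩ := hb
  exact ⟨_, 𝓕.cls_add ha hb⟩

theorem HasCls.sub {i : ℤ} {a b : A} {x y : 𝓕.Gr} (ha : 𝓕.HasCls i a x) (hb : 𝓕.HasCls i b y) :
    𝓕.HasCls i (a - b) (x - y) := by
  obtain ⟨ha, rfl⟩ := ha
  obtain ⟨hb, rfl⟩ := hb
  exact ⟨_, 𝓕.cls_sub ha hb⟩

theorem HasCls.mul {i j : ℤ} {a b : A} {x y : 𝓕.Gr} (ha : 𝓕.HasCls i a x)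
    (hb : 𝓕.HasCls j b y) : 𝓕.HasCls (i + j) (a * b) (x * y) := by
  obtain ⟨ha, rfl⟩ := ha
  obtain ⟨hb, rfl⟩ := hb
  exact ⟨_, (𝓕.cls_mul ha hb).symm⟩

theorem hasCls_zero {i : ℤ} {a : A} (ha : a ∈ 𝓕.F (i + 1)) : 𝓕.HasCls i a 0 :=
  ⟨𝓕.anti (by omega) ha, (𝓕.cls_eq_zero_iff _).2 ha⟩

theorem HasCls.sum {ι : Type*} {i : ℤ} {s : Finset ι} {f : ι → A} {x : ι → 𝓕.Gr}
    (h : ∀ k ∈ s, 𝓕.HasCls i (f k) (x k)) : 𝓕.HasCls i (∑ k ∈ s, f k) (∑ k ∈ s, x k) := by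
  classical
  induction s using Finset.induction_on with
  | empty => exact hasCls_zero (Submodule.zero_mem _)
  | insert a s ha ih =>
    rw [Finset.sum_insert ha, Finset.sum_insert ha]
    exact (h a (Finset.mem_insert_self _ _)).add
      (ih fun k hk => h k (Finset.mem_insert_of_mem hk))

variable (𝓕)

/-- The elements of `F^i` whose class lies in a given subalgebra of `gr(A)`. -/
noncomputable def clsPreimage (R : Subalgebra K 𝓕.Gr) (i : ℤ) : Submodule K A :=
  ((Subalgebra.toSubmodule R).comap (𝓕.clsHom i)).map (𝓕.F i).subtype

variable {𝓕} in
theorem mem_clsPreimage {R : Subalgebra K 𝓕.Gr} {i : ℤ} {a : A} :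
    a ∈ 𝓕.clsPreimage R i ↔ ∃ h : a ∈ 𝓕.F i, 𝓕.cls i a h ∈ R :=
  ⟨fun ⟨b, hb, hab⟩ => hab ▸ ⟨b.2, hb⟩, fun ⟨h, ha⟩ => ⟨⟨a, h⟩, ha, rfl⟩⟩

theorem clsPreimage_mul_le (R : Subalgebra K 𝓕.Gr) (i j : ℤ) :
    𝓕.clsPreimage R i * 𝓕.clsPreimage R j ≤ 𝓕.clsPreimage R (i + j) := by
  refine Submodule.mul_le.2 fun a ha b hb => ?_
  obtain ⟨ha, ha'⟩ := mem_clsPreimage.1 ha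
  obtain ⟨hb, hb'⟩ := mem_clsPreimage.1 hb
  exact mem_clsPreimage.2 ⟨𝓕.mul_mem ha hb, 𝓕.cls_mul ha hb ▸ R.mul_mem ha' hb'⟩

theorem range_eq_top_of_le_clsPreimage {R : Subalgebra K 𝓕.Gr}
    (h : ∀ i, 𝓕.F i ≤ 𝓕.clsPreimage R i) : R = ⊤ := by
  refine Algebra.eq_top_iff.2 fun x => ?_
  induction x using gr_induction with
  | h0 => exact R.zero_mem
  | hadd x y hx hy => exact R.add_mem hx hy
  | hcls i a ha => exact (mem_clsPreimage.1 (h i ha)).2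

variable {𝓕}

theorem mem_of_mul_mem (h0 : 𝓕.F 0 = ⊤) {d : ℤ} {x : A} (hx : x ∈ 𝓕.F d)
    (hinj : ∀ y, y * 𝓕.cls d x hx = 0 → y = 0) {i : ℤ} {a : A} (h : a * x ∈ 𝓕.F (i + d)) :
    a ∈ 𝓕.F i := by
  rcases lt_or_ge i 0 with hi | hi
  · exact 𝓕.anti hi.le (h0 ▸ Submodule.mem_top)
  lift i to ℕ using hi
  induction i with
  | zero => exact h0 ▸ Submodule.mem_top
  | succ i ih =>
    have ha : a ∈ 𝓕.F i := ih (𝓕.anti (by omega) h)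
    refine (𝓕.cls_eq_zero_iff ha).1 (hinj _ ?_)
    rw [cls_mul]
    exact (𝓕.cls_eq_zero_iff _).2 (𝓕.anti (by push_cast; omega) h)

end ClassArithmetic

section GradedMap

variable {K A B : Type*} [CommRing K] [Ring A] [Algebra K A] [Ring B] [Algebra K B]
  {𝓕 : AlgFiltration K A} {𝓖 : AlgFiltration K B}

theorem grMap_apply (f : A →ₐ[K] B) (hf : IsFiltered 𝓕 𝓖 f) (x : 𝓕.Gr) (i : ℤ) :
    grMap f hf x i = mapPiece f hf i (x i) := by
  induction x using gr_induction with
  | h0 => simp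
  | hadd x y hx hy => rw [map_add, DirectSum.add_apply, DirectSum.add_apply, hx, hy, map_add]
  | hcls j a ha =>
    rw [grMap_cls, cls, cls, DirectSum.lof_eq_of, DirectSum.lof_eq_of]
    by_cases hij : i = j
    · subst hij
      rw [DirectSum.of_eq_same, DirectSum.of_eq_same]
      rfl
    · rw [DirectSum.of_eq_of_ne _ _ _ hij, DirectSum.of_eq_of_ne _ _ _ hij, map_zero]

theorem mem_range_lof_of_grMap {f : A →ₐ[K] B} {hf : IsFiltered 𝓕 𝓖 f}
    (hinj : Function.Injective (grMap f hf)) {n : ℤ} {x : 𝓕.Gr}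
    (hx : grMap f hf x ∈ LinearMap.range (DirectSum.lof K ℤ 𝓖.Piece n)) :
    x ∈ LinearMap.range (DirectSum.lof K ℤ 𝓕.Piece n) := by
  obtain ⟨y, hy⟩ := hx
  refine ⟨x n, hinj (DFinsupp.ext fun i => ?_)⟩
  change grMap f hf _ i = grMap f hf x i
  rcases eq_or_ne i n with rfl | hi
  · rw [grMap_apply, grMap_apply, DirectSum.lof_apply]
  · rw [grMap_apply, ← hy, DirectSum.lof_eq_of, DirectSum.lof_eq_of, DirectSum.of_eq_of_ne _ _ _ hi,
      DirectSum.of_eq_of_ne _ _ _ hi, map_zero]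

end GradedMap

section LeadingCoeff

variable {K A : Type*} [CommRing K] [Ring A] [Algebra K A]

/-- Linear maps `c i : A → C`, `i ∈ ℤ`, extracting from an element of `F^i` a coefficient which only
depends on its class in `F^i / F^(i+1)`. Contrary to the class, `c i` is defined on all of `A`. -/
structure LeadingCoeff (𝓕 : AlgFiltration K A) (C : Type*) [AddCommGroup C] [Module K C] where
  c : ℤ → A →ₗ[K] C
  eq_zero : ∀ {i j : ℤ}, i < j → ∀ {a : A}, a ∈ 𝓕.F j → c i a = 0
  eq_zero_of_neg : ∀ {i : ℤ}, i < 0 → ∀ a, c i a = 0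

variable {𝓕 : AlgFiltration K A} {C : Type*} [AddCommGroup C] [Module K C]

namespace LeadingCoeff

/-- The linear map `gr(A) → C`, `[a]_i ↦ c i a`. -/
noncomputable def toGr (l : LeadingCoeff 𝓕 C) : 𝓕.Gr →ₗ[K] C :=
  DirectSum.toModule K ℤ C fun i =>
    Submodule.liftQ _ ((l.c i).domRestrict (𝓕.F i)) fun _ ha => l.eq_zero (lt_add_one i) ha

theorem toGr_cls (l : LeadingCoeff 𝓕 C) {i : ℤ} {a : A} (ha : a ∈ 𝓕.F i) :
    l.toGr (𝓕.cls i a ha) = l.c i a :=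
  DirectSum.toModule_lof K i _

/-- Composition of the coefficients with a linear map. -/
noncomputable def map {D : Type*} [AddCommGroup D] [Module K D] (l : LeadingCoeff 𝓕 C)
    (φ : C →ₗ[K] D) : LeadingCoeff 𝓕 D where
  c i := φ ∘ₗ l.c i
  eq_zero hij a ha := by rw [LinearMap.comp_apply, l.eq_zero hij ha, map_zero]
  eq_zero_of_neg hi a := by rw [LinearMap.comp_apply, l.eq_zero_of_neg hi, map_zero]

theorem toGr_map {D : Type*} [AddCommGroup D] [Module K D] (l : LeadingCoeff 𝓕 C)
    (φ : C →ₗ[K] D) (x : 𝓕.Gr) : (l.map φ).toGr x = φ (l.toGr x) := by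
  induction x using gr_induction with
  | h0 => simp
  | hadd x y hx hy => rw [map_add, hx, hy, map_add, map_add]
  | hcls i a ha => rw [toGr_cls, toGr_cls]; rfl

/-- Restriction of the coefficients to a subalgebra with its induced filtration. -/
noncomputable def restrict (l : LeadingCoeff 𝓕 C) (S : Subalgebra K A) :
    LeadingCoeff (𝓕.restrict S) C where
  c i := l.c i ∘ₗ S.val.toLinearMap
  eq_zero hij _ ha := l.eq_zero hij ha
  eq_zero_of_neg hi _ := l.eq_zero_of_neg hi _

theorem toGr_restrict (l : LeadingCoeff 𝓕 C) (S : Subalgebra K A) (x : (𝓕.restrict S).Gr) :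
    (l.restrict S).toGr x = l.toGr (grMap S.val (isFiltered_val 𝓕 S) x) := by
  induction x using gr_induction with
  | h0 => simp
  | hadd x y hx hy => rw [map_add, hx, hy, map_add, map_add]
  | hcls i a ha => rw [toGr_cls, grMap_cls, toGr_cls]; rfl

end LeadingCoeff

end LeadingCoeff

section Series

open PowerSeries

variable {K A R : Type*} [CommRing K] [Ring A] [Algebra K A] [Ring R] [Algebra K R]

theorem coeff_add_mul_of_le_order {f g : R⟦X⟧} {i j : ℕ} (hf : i ≤ f.order) (hg : j ≤ g.order) :
    coeff (i + j) (f * g) = coeff i f * coeff j g := by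
  rw [coeff_mul]
  refine Finset.sum_eq_single (i, j) (fun p hp hne => ?_) (fun h => absurd (by simp) h)
  rw [Finset.HasAntidiagonal.mem_antidiagonal] at hp
  rcases lt_trichotomy p.1 i with h | h | h
  · rw [coeff_of_lt_order _ ((Nat.cast_lt.2 h).trans_le hf), zero_mul]
  · exact absurd (Prod.ext h (by omega)) hne
  · rw [coeff_of_lt_order _ ((Nat.cast_lt.2 (by omega : p.2 < j)).trans_le hg), mul_zero]

/-- The elements of `A` whose expansion has order at least `m`. -/
noncomputable def orderGE (f : A →ₐ[K] R⟦X⟧) (m : ℕ) : Submodule K A where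
  carrier := {a | m ≤ (f a).order}
  add_mem' {a b} ha hb := by
    change m ≤ (f (a + b)).order
    exact map_add f a b ▸ (le_min ha hb).trans (min_order_le_order_add _ _)
  zero_mem' := by simp
  smul_mem' c a ha := by
    change m ≤ (f (c • a)).order
    rw [map_smul, ← algebraMap_smul R c (f a)]
    exact ha.trans le_order_smul

theorem orderGE_zero (f : A →ₐ[K] R⟦X⟧) : orderGE f 0 = ⊤ :=
  eq_top_iff.2 fun a _ => show ((0 : ℕ) : ℕ∞) ≤ (f a).order by simp

theorem orderGE_mul_le (f : A →ₐ[K] R⟦X⟧) (m n : ℕ) :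
    orderGE f m * orderGE f n ≤ orderGE f (m + n) := by
  refine Submodule.mul_le.2 fun a ha b hb => ?_
  change ((m + n : ℕ) : ℕ∞) ≤ (f (a * b)).order
  rw [map_mul, Nat.cast_add]
  exact (add_le_add ha hb).trans (le_order_mul _ _)

variable {𝓕 : AlgFiltration K A}

/-- The leading coefficients of a power series expansion. -/
noncomputable def seriesCoeff (f : A →ₐ[K] R⟦X⟧) (hf : ∀ n : ℕ, 𝓕.F n ≤ orderGE f n) :
    LeadingCoeff 𝓕 R where
  c i := if 0 ≤ i then ((coeff i.toNat).restrictScalars K) ∘ₗ f.toLinearMap else 0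
  eq_zero {i j} hij a ha := by
    split_ifs with hi
    · lift i to ℕ using hi
      lift j to ℕ using by omega
      exact coeff_of_lt_order _ (lt_of_lt_of_le (by simpa using hij) (hf j ha))
    · rfl
  eq_zero_of_neg hi a := by rw [if_neg hi.not_ge]; rfl

variable {f : A →ₐ[K] R⟦X⟧} {hf : ∀ n : ℕ, 𝓕.F n ≤ orderGE f n}

theorem seriesCoeff_natCast (n : ℕ) (a : A) : (seriesCoeff f hf).c n a = coeff n (f a) := by
  simp [seriesCoeff]

theorem seriesCoeff_mul (h0 : 𝓕.F 0 = ⊤) {i j : ℤ} {a b : A} (ha : a ∈ 𝓕.F i) (hb : b ∈ 𝓕.F j) :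
    (seriesCoeff f hf).c (i + j) (a * b) =
      (seriesCoeff f hf).c i a * (seriesCoeff f hf).c j b := by
  have hmem (a : A) : a ∈ 𝓕.F 0 := h0 ▸ Submodule.mem_top
  rcases lt_or_ge i 0 with hi | hi
  · rw [LeadingCoeff.eq_zero_of_neg _ hi, zero_mul]
    exact LeadingCoeff.eq_zero _ (by omega) (𝓕.mul_mem (hmem a) hb)
  rcases lt_or_ge j 0 with hj | hj
  · rw [LeadingCoeff.eq_zero_of_neg _ hj, mul_zero]
    exact LeadingCoeff.eq_zero _ (by omega) (𝓕.mul_mem ha (hmem b))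
  lift i to ℕ using hi
  lift j to ℕ using hj
  rw [← Nat.cast_add, seriesCoeff_natCast, seriesCoeff_natCast, seriesCoeff_natCast, map_mul]
  exact coeff_add_mul_of_le_order (hf i ha) (hf j hb)

/-- The algebra morphism `gr(A) → R` sending the class of an element to the leading coefficient of
its expansion. -/
noncomputable def seriesSymbol (f : A →ₐ[K] R⟦X⟧) (hf : ∀ n : ℕ, 𝓕.F n ≤ orderGE f n)
    (h0 : 𝓕.F 0 = ⊤) : 𝓕.Gr →ₐ[K] R :=
  AlgHom.ofLinearMap (seriesCoeff f hf).toGr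
    (by
      rw [← cls_one, LeadingCoeff.toGr_cls]
      exact (seriesCoeff_natCast 0 1).trans (by rw [map_one, coeff_zero_one]))
    (fun x y => by
      induction x using gr_induction with
      | h0 => simp
      | hadd x x' hx hx' => rw [add_mul, map_add, hx, hx', map_add, add_mul]
      | hcls i a ha =>
        induction y using gr_induction with
        | h0 => simp
        | hadd y y' hy hy' => rw [mul_add, map_add, hy, hy', map_add, mul_add]
        | hcls j b hb => simp only [cls_mul, LeadingCoeff.toGr_cls, seriesCoeff_mul h0 ha hb])

end Series

section GrTensor

variable {K A B : Type*} [CommRing K] [Ring A] [Algebra K A] [Ring B] [Algebra K B]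
  {𝓕 : AlgFiltration K A} {𝓖 : AlgFiltration K B}

theorem tensor_le {m : ℤ} {P : Submodule K (A ⊗[K] B)}
    (h : ∀ i j, i + j = m → ∀ a ∈ 𝓕.F i, ∀ b ∈ 𝓖.F j, a ⊗ₜ[K] b ∈ P) :
    (𝓕.tensor 𝓖).F m ≤ P :=
  iSup_le fun i => iSup_le fun j => iSup_le fun hij =>
    Submodule.map₂_le.2 fun a ha b hb => h i j hij a ha b hb

theorem hasCls_tmul {i j m : ℤ} (h : i + j = m) {a : A} {b : B} (ha : a ∈ 𝓕.F i)
    (hb : b ∈ 𝓖.F j) : (𝓕.tensor 𝓖).HasCls m (a ⊗ₜ b)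
      (grTensor 𝓕 𝓖 (𝓕.cls i a ha ⊗ₜ 𝓖.cls j b hb)) := by
  subst h
  exact ⟨tmul_mem_tensor rfl ha hb, (grTensor_cls_tmul_cls ha hb).symm⟩

theorem grTensor_surjective : Function.Surjective (grTensor 𝓕 𝓖) := by
  refine (AlgHom.range_eq_top _).1 (range_eq_top_of_le_clsPreimage _ fun m => tensor_le ?_)
  intro i j hij a ha b hb
  obtain ⟨h, hcls⟩ := hasCls_tmul hij ha hb
  exact mem_clsPreimage.2 ⟨h, _, hcls.symm⟩

variable {C D : Type*} [AddCommGroup C] [Module K C] [AddCommGroup D] [Module K D]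

/-- The convolution `∑_{p + q = m, p, q ≥ 0} c_p ⊗ d_q` of two families of coefficients. -/
noncomputable def LeadingCoeff.tensor (l : LeadingCoeff 𝓕 C) (l' : LeadingCoeff 𝓖 D) :
    LeadingCoeff (𝓕.tensor 𝓖) (C ⊗[K] D) where
  c m := ∑ p ∈ Finset.Icc 0 m, TensorProduct.map (l.c p) (l'.c (m - p))
  eq_zero {m n} hmn x hx := by
    rw [← LinearMap.mem_ker]
    refine tensor_le (fun i j hij a ha b hb => ?_) hx
    rw [LinearMap.mem_ker, LinearMap.sum_apply]
    refine Finset.sum_eq_zero fun p _ => ?_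
    rw [TensorProduct.map_tmul]
    rcases lt_or_ge p i with h | h
    · rw [l.eq_zero h ha, TensorProduct.zero_tmul]
    · rw [l'.eq_zero (by omega : m - p < j) hb, TensorProduct.tmul_zero]
  eq_zero_of_neg hi x := by rw [Finset.Icc_eq_empty hi.not_ge, Finset.sum_empty]; rfl

theorem LeadingCoeff.tensor_tmul (l : LeadingCoeff 𝓕 C) (l' : LeadingCoeff 𝓖 D) {i j : ℤ}
    {a : A} {b : B} (ha : a ∈ 𝓕.F i) (hb : b ∈ 𝓖.F j) :
    (l.tensor l').c (i + j) (a ⊗ₜ b) = l.c i a ⊗ₜ l'.c j b := by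
  simp only [tensor, LinearMap.sum_apply, TensorProduct.map_tmul]
  rw [Finset.sum_eq_single i, add_sub_cancel_left]
  · intro p _ hp
    rcases lt_or_gt_of_ne hp with h | h
    · rw [l.eq_zero h ha, TensorProduct.zero_tmul]
    · rw [l'.eq_zero (by omega : i + j - p < j) hb, TensorProduct.tmul_zero]
  · intro h
    rw [add_sub_cancel_left]
    rcases lt_or_ge i 0 with hi | hi
    · rw [l.eq_zero_of_neg hi, TensorProduct.zero_tmul]
    · rw [l'.eq_zero_of_neg (by rw [Finset.mem_Icc] at h; omega), TensorProduct.tmul_zero]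

theorem LeadingCoeff.toGr_tensor_comp_grTensor (l : LeadingCoeff 𝓕 C) (l' : LeadingCoeff 𝓖 D) :
    (l.tensor l').toGr ∘ₗ (grTensor 𝓕 𝓖).toLinearMap = TensorProduct.map l.toGr l'.toGr := by
  refine TensorProduct.ext' fun x y => ?_
  rw [LinearMap.comp_apply, AlgHom.toLinearMap_apply, TensorProduct.map_tmul]
  induction x using gr_induction with
  | h0 => simp
  | hadd x x' hx hx' => simp only [TensorProduct.add_tmul, map_add, hx, hx']
  | hcls i a ha =>
    induction y using gr_induction with
    | h0 => simp
    | hadd y y' hy hy' => simp only [TensorProduct.tmul_add, map_add, hy, hy']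
    | hcls j b hb => simp only [grTensor_cls_tmul_cls, toGr_cls, tensor_tmul l l' ha hb]

theorem grTensor_bijective {l : LeadingCoeff 𝓕 C} {l' : LeadingCoeff 𝓖 D}
    (hl : Function.Bijective l.toGr) (hl' : Function.Bijective l'.toGr) :
    Function.Bijective (grTensor 𝓕 𝓖) := by
  refine ⟨Function.Injective.of_comp (f := (l.tensor l').toGr) ?_, grTensor_surjective⟩
  change Function.Injective ((l.tensor l').toGr ∘ₗ (grTensor 𝓕 𝓖).toLinearMap)
  rw [l.toGr_tensor_comp_grTensor l']
  exact (TensorProduct.congr (.ofBijective _ hl) (.ofBijective _ hl')).injective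

end GrTensor

end AlgFiltration

/-! ### Generators of the ideal `I_N` -/

section IdealGenerators

variable {K : Type*} [CommRing K]

theorem VB_mem_of_gen (E : Subalgebra K (VB K)) (h : ∀ i, bX K i 1 ∈ E)
    (h' : ∀ i, bX K i (-1) ∈ E) (v : VB K) : v ∈ E := by
  induction v using MonoidAlgebra.induction_on with
  | of g =>
    induction g using FreeGroup.induction_on with
    | C1 => rw [map_one]; exact E.one_mem
    | of i => simpa [bX] using h i
    | inv_of i _ => simpa [bX] using h' i
    | mul a b ha hb => rw [map_mul]; exact E.mul_mem ha hb
  | add a b ha hb => exact E.add_mem ha hb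
  | smul c a ha => exact E.smul_mem ha c

theorem VB_algHom_ext {A : Type*} [Ring A] [Algebra K A] {f g : VB K →ₐ[K] A}
    (h : ∀ i, f (bX K i 1) = g (bX K i 1)) : f = g :=
  MonoidAlgebra.algHom_ext' (FreeGroup.ext_hom _ _ fun i => by simpa [bX] using h i)
    (Subsingleton.elim _ _)

theorem bX_natCast (i : Fin 2) (n : ℕ) : bX K i n = bX K i 1 ^ n := by
  simp only [bX, zpow_natCast, zpow_one, map_pow]

variable {N : ℕ} [NeZero N]

theorem algToMu_bX_zero (n : ℤ) :
    algToMu K N (bX K 0 n) = MonoidAlgebra.of K _ (zetaN N ^ n) := by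
  simp [algToMu, bX, toMu]

theorem algToMu_bX_one (n : ℤ) : algToMu K N (bX K 1 n) = 1 := by
  simp [algToMu, bX, toMu, MonoidAlgebra.one_def]

theorem algHom_eq_zero_of_mem_idealI {A : Type*} [Ring A] [Algebra K A] {f : VB K →ₐ[K] A}
    (h0 : f (bX K 0 N) = 1) (h1 : f (bX K 1 1) = 1) {v : VB K} (hv : v ∈ idealI K N) :
    f v = 0 := by
  have h0 : f (bX K 0 1) ^ N = 1 := by rw [← map_pow, ← bX_natCast, h0]
  let φ : rootsOfUnity N ℂ →* Aˣ :=
    monoidHomOfForallMemZpowers (mem_zpowers_zetaN N) (g' := Units.ofPowEqOne _ N h0 (NeZero.ne N))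
      (by
        rw [zetaN_orderOf]
        exact orderOf_dvd_of_pow_eq_one (Units.pow_ofPowEqOne h0 (NeZero.ne N)))
  have hφ : φ (zetaN N) = f (bX K 0 1) :=
    congrArg Units.val (monoidHomOfForallMemZpowers_apply_gen _ _)
  have hf : (MonoidAlgebra.lift K A _ ((Units.coeHom A).comp φ)).comp (algToMu K N) = f := by
    refine VB_algHom_ext (Fin.forall_fin_two.2 ⟨?_, ?_⟩)
    · rw [AlgHom.comp_apply, algToMu_bX_zero, MonoidAlgebra.lift_of, zpow_one]
      exact hφ
    · rw [AlgHom.comp_apply, algToMu_bX_one, map_one, h1]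
  rw [← hf, AlgHom.comp_apply, show algToMu K N v = 0 from hv, map_zero]

theorem smul_eq_zero_of_mem_idealI {M : Type*} [AddCommGroup M] [Module K M] [Module (VB K) M]
    [IsScalarTower K (VB K) M] (h0 : ∀ m : M, (bX K 0 N - 1) • m = 0)
    (h1 : ∀ m : M, (bX K 1 1 - 1) • m = 0) {v : VB K} (hv : v ∈ idealI K N) (m : M) :
    v • m = 0 := by
  have h {v : VB K} (hv : ∀ m : M, (v - 1) • m = 0) : Algebra.lsmul K K M v = 1 :=
    LinearMap.ext fun m => sub_eq_zero.1 <| by simpa [sub_smul] using hv m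
  exact LinearMap.congr_fun (algHom_eq_zero_of_mem_idealI (h h0) (h h1) hv) m

theorem idealI_mul_le {P Q : Submodule K (VB K)} (hP : ∀ v, v ∈ leftStab P)
    (hQ : ∀ v, v ∈ leftStab Q) (h0 : ∀ u ∈ P, (bX K 0 N - 1) * u ∈ Q)
    (h1 : ∀ u ∈ P, (bX K 1 1 - 1) * u ∈ Q) : idealI K N * P ≤ Q := by
  let P' : Submodule (VB K) (VB K) := { P with smul_mem' := hP }
  let Q' : Submodule (VB K) (VB K) := { Q with smul_mem' := hQ }
  have hM {v : VB K} (hv : ∀ u ∈ P, v * u ∈ Q) (m : P'.map Q'.mkQ) : v • m = 0 := by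
    obtain ⟨_, u, hu, rfl⟩ := m
    exact Subtype.ext ((Submodule.Quotient.mk_eq_zero Q').2 (hv u hu))
  refine Submodule.mul_le.2 fun v hv u hu => ?_
  have h := smul_eq_zero_of_mem_idealI (M := P'.map Q'.mkQ) (hM h0) (hM h1) hv
    ⟨Q'.mkQ u, Submodule.mem_map_of_mem hu⟩
  exact (Submodule.Quotient.mk_eq_zero Q').1 (congrArg Subtype.val h)

theorem filtVB_le {P : ℕ → Submodule K (VB K)} (h0 : P 0 = ⊤)
    (h : ∀ m, idealI K N * P m ≤ P (m + 1)) (m : ℕ) : (filtVB K N).F m ≤ P m := by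
  have hpow (m : ℕ) : idealI K N ^ m * ⊤ ≤ P m := by
    induction m with
    | zero => rw [h0]; exact le_top
    | succ m ih =>
      rw [pow_succ', mul_assoc]
      exact (mul_le_mul' le_rfl ih).trans (h m)
  rcases m with _ | m
  · exact h0 ▸ le_top
  · refine fun v hv => hpow (m + 1) ?_
    change v ∈ filVB K N (m + 1 : ℕ) at hv
    rw [filVB_of_pos (by positivity), Int.toNat_natCast] at hv
    simpa using Submodule.mul_mem_mul hv (Submodule.mem_top (x := 1))

end IdealGenerators

section RhoSurjective

variable (K : Type*) [CommRing K] (N : ℕ) [NeZero N]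

theorem filtVB_eq_top {i : ℤ} (hi : i ≤ 0) : (filtVB K N).F i = ⊤ := filVB_of_nonpos hi

theorem rhoV_e0 : rhoV K N (drι K N .e0) = (filtVB K N).cls 1 (bX K 0 N - 1)
    (mem_filtVB_one K N (bX_zero_N_sub_one_mem K N)) := liftVDR_ι _ _ _ _ _

theorem rhoV_e1 : rhoV K N (drι K N .e1) = (filtVB K N).cls 1 (bX K 1 1 - 1)
    (mem_filtVB_one K N (bX_one_one_sub_one_mem K N)) := liftVDR_ι _ _ _ _ _

theorem clsX0_zpow_val (n : ℤ) : ((clsX0 K N ^ n : ((filtVB K N).Gr)ˣ) : (filtVB K N).Gr) =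
    (filtVB K N).cls 0 (bX K 0 n) (filtVB_zero K N _) := by
  obtain ⟨m, rfl | rfl⟩ := n.eq_nat_or_neg
  · rw [zpow_natCast, clsX0_pow_val]
  · rw [zpow_neg, zpow_natCast, ← Units.mul_eq_one_iff_inv_eq, clsX0_pow_val,
      AlgFiltration.cls_mul, ← AlgFiltration.cls_one]
    exact AlgFiltration.cls_congr _ rfl (by rw [← bX_add, add_neg_cancel, bX_zero]) _ _

theorem rhoV_root (n : ℤ) : rhoV K N (drι K N (.root (zetaN N ^ n))) =
    (filtVB K N).cls 0 (bX K 0 n) (filtVB_zero K N _) := by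
  rw [rhoV, liftVDR_ι]
  change ((muToGr K N (zetaN N ^ n) : ((filtVB K N).Gr)ˣ) : (filtVB K N).Gr) = _
  rw [map_zpow, muToGr_zetaN, clsX0_zpow_val]

theorem clsPreimage_rhoV_zero : (filtVB K N).clsPreimage (rhoV K N).range 0 = ⊤ := by
  refine eq_top_iff.2 fun v _ => ?_
  induction v using MonoidAlgebra.induction_on with
  | of g =>
    obtain ⟨n, hn⟩ := mem_zpowers_zetaN N (toMu N g)
    have h : MonoidAlgebra.of K _ g - bX K 0 n ∈ idealI K N := by
      change algToMu K N (MonoidAlgebra.of K _ g - bX K 0 n) = 0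
      rw [map_sub, algToMu_bX_zero, sub_eq_zero]
      simp [algToMu, ← hn]
    refine AlgFiltration.mem_clsPreimage.2 ⟨filtVB_zero K N _, drι K N (.root (zetaN N ^ n)), ?_⟩
    exact (rhoV_root K N n).trans (AlgFiltration.cls_sub_eq _ _ _ (mem_filtVB_one K N h)).symm
  | add a b ha hb => exact Submodule.add_mem _ (ha trivial) (hb trivial)
  | smul c a ha => exact Submodule.smul_mem _ c (ha trivial)

theorem idealI_le_clsPreimage_rhoV :
    idealI K N ≤ (filtVB K N).clsPreimage (rhoV K N).range 1 := by
  have hstab (v : VB K) : v ∈ leftStab ((filtVB K N).clsPreimage (rhoV K N).range 1) :=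
    fun u hu => by
      simpa using AlgFiltration.clsPreimage_mul_le _ _ 0 1
        (Submodule.mul_mem_mul (clsPreimage_rhoV_zero K N ▸ Submodule.mem_top (x := v)) hu)
  have hgen {u : VB K} (h : u ∈ idealI K N)
      (hu : (filtVB K N).cls 1 u (mem_filtVB_one K N h) ∈ (rhoV K N).range) (v : VB K) :
      u * v ∈ (filtVB K N).clsPreimage (rhoV K N).range 1 := by
    simpa using AlgFiltration.clsPreimage_mul_le _ _ 1 0
      (Submodule.mul_mem_mul (AlgFiltration.mem_clsPreimage.2 ⟨_, hu⟩)
        (clsPreimage_rhoV_zero K N ▸ Submodule.mem_top (x := v)))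
  have h := idealI_mul_le (P := ⊤) (fun _ _ _ => trivial) hstab
    (fun u _ => hgen (bX_zero_N_sub_one_mem K N) ⟨_, rhoV_e0 K N⟩ u)
    (fun u _ => hgen (bX_one_one_sub_one_mem K N) ⟨_, rhoV_e1 K N⟩ u)
  exact fun v hv => by simpa using h (Submodule.mul_mem_mul hv (Submodule.mem_top (x := 1)))

theorem rhoV_surjective : Function.Surjective (rhoV K N) := by
  refine (AlgHom.range_eq_top _).1 (AlgFiltration.range_eq_top_of_le_clsPreimage _ fun i => ?_)
  rcases lt_or_ge i 0 with hi | hi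
  · intro v hv
    refine AlgFiltration.mem_clsPreimage.2 ⟨hv, ?_⟩
    have hv' : v ∈ (filtVB K N).F (i + 1) := filtVB_eq_top K N (show i + 1 ≤ 0 by omega) ▸ trivial
    rw [(AlgFiltration.cls_eq_zero_iff _ hv).2 hv']
    exact Subalgebra.zero_mem _
  lift i to ℕ using hi
  refine filtVB_le (P := fun m => (filtVB K N).clsPreimage (rhoV K N).range m)
    (clsPreimage_rhoV_zero K N) (fun m => ?_) i
  push_cast
  rw [add_comm (m : ℤ) 1]
  exact (mul_le_mul' (idealI_le_clsPreimage_rhoV K N) le_rfl).trans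
    (AlgFiltration.clsPreimage_mul_le _ _ 1 m)

end RhoSurjective

/-! ### The matrix expansion of `K F₂` and the morphism `ρ^V_N` -/

section VDRInduction

variable {K : Type*} [CommRing K] {N : ℕ}

theorem VDR_induction {P : VDR K N → Prop} (algebraMap : ∀ c : K, P (algebraMap K _ c))
    (gen : ∀ g, P (drι K N g)) (mul : ∀ a b, P a → P b → P (a * b))
    (add : ∀ a b, P a → P b → P (a + b)) (v : VDR K N) : P v := by
  obtain ⟨a, rfl⟩ := mkVDR_surjective K N v
  induction a using FreeAlgebra.induction with
  | grade0 c => rw [AlgHom.commutes]; exact algebraMap c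
  | grade1 g => exact gen g
  | mul a b ha hb => rw [map_mul]; exact mul _ _ ha hb
  | add a b ha hb => rw [map_add]; exact add _ _ ha hb

end VDRInduction

section RegularRepresentation

theorem sum_range_zetaN_pow {M : Type*} [AddCommMonoid M] (N : ℕ) [NeZero N]
    (f : rootsOfUnity N ℂ → M) (a : ℤ) :
    ∑ k ∈ Finset.range N, f (zetaN N ^ (a + k)) = ∑ η, f η := by
  have himg : (Finset.range N).image (zetaN N ^ ·) = Finset.univ := by
    simpa only [zetaN_orderOf] using IsCyclic.image_range_orderOf (mem_zpowers_zetaN N)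
  have hinj : Set.InjOn (zetaN N ^ ·) (Finset.range N : Set ℕ) := by
    simpa only [zetaN_orderOf, Finset.coe_range] using pow_injOn_Iio_orderOf (x := zetaN N)
  rw [← Equiv.sum_comp (Equiv.mulLeft (zetaN N ^ a)) f, ← himg, Finset.sum_image hinj]
  simp only [zpow_add, zpow_natCast, Equiv.coe_mulLeft]

variable (K : Type*) [CommRing K] (N : ℕ) [NeZero N]

/-- The matrices over `V^DR_N` with rows and columns indexed by `μ_N`. -/
abbrev MuMatrix : Type _ := Matrix (rootsOfUnity N ℂ) (rootsOfUnity N ℂ) (VDR K N)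

/-- The regular representation of `μ_N` twisted by the inclusion `μ_N ⊂ V^DR_N`. -/
noncomputable def muRep : rootsOfUnity N ℂ →* MuMatrix K N where
  toFun ζ := Matrix.of fun η θ => if η * ζ = θ then drι K N (.root ζ) else 0
  map_one' := by
    ext η θ
    simp [drι_one, Matrix.one_apply]
  map_mul' ζ ξ := by
    ext η θ
    simp only [Matrix.mul_apply, Matrix.of_apply, ite_mul, zero_mul]
    rw [Finset.sum_ite_eq Finset.univ (η * ζ)]
    simp [drι_mul, mul_assoc]

theorem muRep_apply (ζ η θ : rootsOfUnity N ℂ) :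
    muRep K N ζ η θ = if η * ζ = θ then drι K N (.root ζ) else 0 := rfl

theorem mul_single_mul_apply {n R : Type*} [Fintype n] [DecidableEq n] [Ring R]
    (A B : Matrix n n R) (i j : n) (a : R) (k l : n) :
    (A * Matrix.single i j a * B) k l = A k i * a * B j l := by
  rw [Matrix.mul_apply, Finset.sum_eq_single j, Matrix.mul_single_apply_same]
  · intro m _ hm
    rw [Matrix.mul_single_apply_of_ne _ _ _ _ _ hm, zero_mul]
  · simp

theorem sum_muRep_conj : ∑ ζ, muRep K N ζ * Matrix.single 1 1 (drι K N .e0) * muRep K N ζ⁻¹ =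
    Matrix.scalar _ (drι K N .e0) := by
  ext η θ
  rw [Matrix.sum_apply, Finset.sum_eq_single η⁻¹]
  · simp [mul_single_mul_apply, muRep_apply, Matrix.diagonal_apply, drι_comm, mul_assoc, drι_mul,
      drι_one]
  · intro ζ _ hζ
    rw [mul_single_mul_apply, muRep_apply, if_neg fun h => hζ (eq_inv_of_mul_eq_one_right h),
      zero_mul, zero_mul]
  · simp

end RegularRepresentation

section Expansion

open PowerSeries

theorem coeff_one_pow_eq_sum {R : Type*} [Ring R] (f : R⟦X⟧) (n : ℕ) :
    coeff 1 (f ^ n) = ∑ k ∈ Finset.range n,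
      constantCoeff f ^ k * coeff 1 f * constantCoeff f ^ (n - 1 - k) := by
  induction n with
  | zero => simp [coeff_one]
  | succ n ih =>
    have hmul : coeff 1 (f ^ n * f) =
        constantCoeff f ^ n * coeff 1 f + coeff 1 (f ^ n) * constantCoeff f := by
      simp [coeff_mul, Finset.Nat.antidiagonal_succ]
    rw [pow_succ, hmul, ih, Finset.sum_range_succ, Finset.sum_mul, add_comm]
    congr 1
    · refine Finset.sum_congr rfl fun k hk => ?_
      rw [Finset.mem_range] at hk
      rw [mul_assoc, ← pow_succ, show n - 1 - k + 1 = n + 1 - 1 - k by omega]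
    · simp

variable (K : Type*) [CommRing K] (N : ℕ) [NeZero N]

/-- A power series with invertible constant coefficient, as a unit. -/
noncomputable def seriesUnit {R : Type*} [Ring R] (f : R⟦X⟧) (u : Rˣ)
    (h : constantCoeff f = u) : (R⟦X⟧)ˣ :=
  ⟨f, invOfUnit f u, mul_invOfUnit f u h, invOfUnit_mul f u h⟩

/-- The series `ζ_N (1 + E X)`, where the matrix `E` has the single nonzero entry `e₀`. -/
noncomputable def serX0 : (MuMatrix K N)⟦X⟧ :=
  C (muRep K N (zetaN N)) * (1 + C (Matrix.single 1 1 (drι K N .e0)) * X)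

/-- The series `1 + e₁ X`. -/
noncomputable def serX1 : (MuMatrix K N)⟦X⟧ := 1 + C (Matrix.scalar _ (drι K N .e1)) * X

theorem constantCoeff_serX0 : constantCoeff (serX0 K N) =
    (Units.map (muRep K N) (toUnits (zetaN N)) : (MuMatrix K N)ˣ) := by
  simp [serX0]

theorem constantCoeff_serX1 : constantCoeff (serX1 K N) = (1 : (MuMatrix K N)ˣ) := by
  simp [serX1]

/-- The expansion of `K F₂` in matrix power series. Only one of the `N` diagonal matrix entries of
`1 + E X` is `1 + e₀ X`, which makes `e₀`, and not `N e₀`, the leading coefficient of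
`X₀^N - 1`. -/
noncomputable def toSeries : VB K →ₐ[K] (MuMatrix K N)⟦X⟧ :=
  MonoidAlgebra.lift K _ _ ((Units.coeHom _).comp (FreeGroup.lift
    ![seriesUnit _ _ (constantCoeff_serX0 K N), seriesUnit _ _ (constantCoeff_serX1 K N)]))

theorem toSeries_bX_zero : toSeries K N (bX K 0 1) = serX0 K N := by
  simp [toSeries, bX, seriesUnit]

theorem toSeries_bX_one : toSeries K N (bX K 1 1) = serX1 K N := by
  simp [toSeries, bX, seriesUnit]

theorem constantCoeff_toSeries_bX_zero (n : ℕ) :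
    constantCoeff (toSeries K N (bX K 0 n)) = muRep K N (zetaN N ^ n) := by
  rw [bX_natCast, map_pow, map_pow, toSeries_bX_zero, constantCoeff_serX0, map_pow]
  rfl

theorem coeff_one_toSeries_bX_zero :
    coeff 1 (toSeries K N (bX K 0 N)) = Matrix.scalar _ (drι K N .e0) := by
  have hcoeff : coeff 1 (serX0 K N) =
      muRep K N (zetaN N) * Matrix.single 1 1 (drι K N .e0) := by
    simp [serX0]
  rw [bX_natCast, map_pow, toSeries_bX_zero, coeff_one_pow_eq_sum, hcoeff, ← sum_muRep_conj,
    ← sum_range_zetaN_pow N _ 1]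
  refine Finset.sum_congr rfl fun k hk => ?_
  have hinv : (zetaN N ^ (1 + k : ℤ))⁻¹ = zetaN N ^ (N - 1 - k) := by
    refine inv_eq_of_mul_eq_one_right ?_
    rw [← zpow_natCast, ← zpow_add,
      show (1 + k + (N - 1 - k : ℕ) : ℤ) = N by rw [Finset.mem_range] at hk; omega,
      zpow_natCast, zetaN_pow]
  have hzeta : zetaN N ^ (1 + k : ℤ) = zetaN N ^ k * zetaN N := by
    rw [add_comm, zpow_add_one, zpow_natCast]
  rw [hinv, hzeta, map_mul, map_pow, map_pow, constantCoeff_serX0]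
  simp only [mul_assoc]
  rfl

theorem idealI_le_orderGE : idealI K N ≤ AlgFiltration.orderGE (toSeries K N) 1 := by
  intro v hv
  let f : VB K →ₐ[K] MuMatrix K N :=
    { (constantCoeff (R := MuMatrix K N)).comp (toSeries K N).toRingHom with
      commutes' := fun c => (congrArg constantCoeff ((toSeries K N).commutes c)).trans <| by
        simp [PowerSeries.algebraMap_apply] }
  have h : f v = 0 := algHom_eq_zero_of_mem_idealI
    ((constantCoeff_toSeries_bX_zero K N N).trans (by rw [zetaN_pow, map_one]))
    ((congrArg constantCoeff (toSeries_bX_one K N)).trans (constantCoeff_serX1 K N)) hv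
  exact PowerSeries.one_le_order_iff_constCoeff_eq_zero.2 h

theorem filtVB_le_orderGE (n : ℕ) : (filtVB K N).F n ≤ AlgFiltration.orderGE (toSeries K N) n :=
  filtVB_le (AlgFiltration.orderGE_zero _) (fun m => by
    rw [add_comm]
    exact (mul_le_mul' (idealI_le_orderGE K N) le_rfl).trans
      (AlgFiltration.orderGE_mul_le _ 1 m)) n

/-- The algebra morphism `gr(V^B_N) → M_{μ_N}(V^DR_N)` given by leading coefficients. -/
noncomputable def symbolVB : (filtVB K N).Gr →ₐ[K] MuMatrix K N :=
  AlgFiltration.seriesSymbol (toSeries K N) (filtVB_le_orderGE K N) (filtVB_eq_top K N le_rfl)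

theorem symbolVB_cls {n : ℕ} {v : VB K} (hv : v ∈ (filtVB K N).F n) :
    symbolVB K N ((filtVB K N).cls n v hv) = coeff n (toSeries K N v) :=
  (AlgFiltration.LeadingCoeff.toGr_cls _ _).trans (AlgFiltration.seriesCoeff_natCast n v)

theorem symbolVB_rhoV_e0 :
    symbolVB K N (rhoV K N (drι K N .e0)) = Matrix.scalar _ (drι K N .e0) := by
  rw [rhoV_e0]
  refine (symbolVB_cls K N (n := 1) _).trans ?_
  rw [map_sub, map_one, map_sub, coeff_one_toSeries_bX_zero]
  simp [coeff_one]

theorem symbolVB_rhoV_e1 :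
    symbolVB K N (rhoV K N (drι K N .e1)) = Matrix.scalar _ (drι K N .e1) := by
  rw [rhoV_e1]
  refine (symbolVB_cls K N (n := 1) _).trans ?_
  rw [map_sub, map_one, toSeries_bX_one]
  simp [serX1]

theorem symbolVB_rhoV_root (ζ : rootsOfUnity N ℂ) :
    symbolVB K N (rhoV K N (drι K N (.root ζ))) = muRep K N ζ := by
  obtain ⟨n, rfl⟩ := mem_powers_iff_mem_zpowers.2 (mem_zpowers_zetaN N ζ)
  have h := rhoV_root K N n
  rw [zpow_natCast] at h
  rw [h]
  refine (symbolVB_cls K N (n := 0) _).trans ?_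
  rw [coeff_zero_eq_constantCoeff_apply, constantCoeff_toSeries_bX_zero]

theorem sum_symbolVB_rhoV (v : VDR K N) (η : rootsOfUnity N ℂ) :
    ∑ θ, symbolVB K N (rhoV K N v) η θ = v := by
  induction v using VDR_induction generalizing η with
  | algebraMap c => simp [Matrix.algebraMap_matrix_apply]
  | gen g =>
    cases g with
    | e0 => simp [symbolVB_rhoV_e0, Matrix.diagonal_apply]
    | e1 => simp [symbolVB_rhoV_e1, Matrix.diagonal_apply]
    | root ζ => simp [symbolVB_rhoV_root, muRep_apply]
  | mul a b ha hb =>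
    simp only [map_mul, Matrix.mul_apply]
    rw [Finset.sum_comm]
    simp only [← Finset.mul_sum, hb, ← Finset.sum_mul, ha]
  | add a b ha hb => simp only [map_add, Matrix.add_apply, Finset.sum_add_distrib, ha, hb]

/-- The leading coefficients on `V^B_N` with values in `V^DR_N`: the sums of the row of index
`1 ∈ μ_N` of the leading matrices. -/
noncomputable def leadVB : AlgFiltration.LeadingCoeff (filtVB K N) (VDR K N) :=
  (AlgFiltration.seriesCoeff (toSeries K N) (filtVB_le_orderGE K N)).map
    (∑ θ, Matrix.entryLinearMap K _ 1 θ)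

theorem leadVB_toGr_rhoV (v : VDR K N) : (leadVB K N).toGr (rhoV K N v) = v := by
  rw [leadVB, AlgFiltration.LeadingCoeff.toGr_map, LinearMap.sum_apply]
  exact sum_symbolVB_rhoV K N v 1

theorem rhoV_bijective : Function.Bijective (rhoV K N) :=
  ⟨Function.LeftInverse.injective (leadVB_toGr_rhoV K N), rhoV_surjective K N⟩

end Expansion

/-! ### The morphism `ρ^W_N` -/

section DeRhamRetraction

variable (K : Type*) [CommRing K] (N : ℕ)

/-- The augmentation of `V^DR_N`: `e₀, e₁ ↦ 0` and `ζ ↦ 1` for `ζ ∈ μ_N`. -/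
noncomputable def augDR : VDR K N →ₐ[K] K :=
  liftVDR (fun g => match g with
    | .e0 => 0
    | .e1 => 0
    | .root _ => 1) (by simp) rfl (by simp)

theorem augDR_e1 : augDR K N (drι K N .e1) = 0 := liftVDR_ι _ _ _ _ _

/-- The triangular representation of `V^DR_N` whose off-diagonal entry is the derivation dual
to `e₁`. -/
noncomputable def triDR : VDR K N →ₐ[K] Matrix (Fin 2) (Fin 2) (VDR K N) :=
  liftVDR (fun g => match g with
    | .e0 => !![drι K N .e0, 0; 0, 0]
    | .e1 => !![drι K N .e1, 1; 0, 0]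
    | .root ζ => !![drι K N (.root ζ), 0; 0, 1])
    (fun ζ η => by simp [drι_mul])
    (by simp [drι_one, Matrix.one_fin_two])
    (fun ζ => by simp [drι_comm])

theorem triDR_eq (v : VDR K N) :
    triDR K N v = !![v, triDR K N v 0 1; 0, algebraMap K _ (augDR K N v)] := by
  induction v using VDR_induction with
  | algebraMap c =>
    rw [AlgHom.commutes, AlgHom.commutes]
    ext i j
    fin_cases i <;> fin_cases j <;> simp [Matrix.algebraMap_matrix_apply]
  | gen g =>
    rw [show triDR K N (drι K N g) = _ from liftVDR_ι _ _ _ _ _,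
      show augDR K N (drι K N g) = _ from liftVDR_ι _ _ _ _ _]
    cases g <;> simp
  | mul a b ha hb =>
    rw [map_mul, ha, hb]
    simp [← Algebra.smul_def]
  | add a b ha hb =>
    rw [map_add, ha, hb]
    simp

/-- The linear map `V^DR_N → V^DR_N` that removes the last letter `e₁`. -/
noncomputable def foxDR : VDR K N →ₗ[K] VDR K N :=
  Matrix.entryLinearMap K _ 0 1 ∘ₗ (triDR K N).toLinearMap

theorem foxDR_mul_e1 (v : VDR K N) : foxDR K N (v * drι K N .e1) = v := by
  change triDR K N (v * drι K N .e1) 0 1 = v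
  rw [map_mul, triDR_eq K N v, show triDR K N (drι K N .e1) = _ from liftVDR_ι _ _ _ _ _]
  simp

theorem foxDR_algebraMap (c : K) : foxDR K N (algebraMap K _ c) = 0 := by
  change triDR K N (algebraMap K _ c) 0 1 = 0
  rw [AlgHom.commutes]
  simp [Matrix.algebraMap_matrix_apply]

theorem eq_zero_of_mul_e1_eq_zero {v : VDR K N} (h : v * drι K N .e1 = 0) : v = 0 := by
  rw [← foxDR_mul_e1 K N v, h, map_zero]

/-- A linear retraction of the inclusion `W^DR_N ⊂ V^DR_N`. -/
noncomputable def retractDR : VDR K N →ₗ[K] WDR K N :=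
  LinearMap.codRestrict (Subalgebra.toSubmodule (WDR K N))
    (Algebra.linearMap K (VDR K N) ∘ₗ (augDR K N).toLinearMap +
      LinearMap.mulRight K (drι K N .e1) ∘ₗ foxDR K N)
    (fun v => ⟨augDR K N v, foxDR K N v, rfl⟩)

theorem retractDR_coe (w : WDR K N) : retractDR K N w = w := by
  obtain ⟨_, c, v, rfl⟩ := w
  apply Subtype.ext
  change algebraMap K _ (augDR K N (algebraMap K _ c + v * drι K N .e1)) +
    foxDR K N (algebraMap K _ c + v * drι K N .e1) * drι K N .e1 =
    algebraMap K _ c + v * drι K N .e1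
  rw [map_add (augDR K N), map_add (foxDR K N), foxDR_mul_e1, foxDR_algebraMap,
    map_mul, augDR_e1, AlgHom.commutes]
  simp

end DeRhamRetraction

section RhoW

variable (K : Type*) [CommRing K] (N : ℕ) [NeZero N]

theorem rhoV_mem_range_lof {n : ℕ} {v : VDR K N} (hv : v ∈ degVDR K N n) :
    rhoV K N v ∈ LinearMap.range (DirectSum.lof K ℤ (filtVB K N).Piece n) := by
  have hgen (g : DRGen N) : ∃ a, (filtVB K N).HasCls g.deg a (rhoV K N (drι K N g)) := by
    rcases g with _ | _ | ζ
    · exact ⟨_, _, (rhoV_e0 K N).symm⟩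
    · exact ⟨_, _, (rhoV_e1 K N).symm⟩
    · obtain ⟨m, rfl⟩ := mem_zpowers_zetaN N ζ
      exact ⟨_, _, (rhoV_root K N m).symm⟩
  have hword (l : List (DRGen N)) : ∃ a, (filtVB K N).HasCls (l.map DRGen.deg).sum a
      (rhoV K N (l.map (drι K N)).prod) := by
    induction l with
    | nil => exact ⟨1, (filtVB K N).one_mem, (map_one _).symm⟩
    | cons g l ih =>
      obtain ⟨a, ha⟩ := hgen g
      obtain ⟨b, hb⟩ := ih
      exact ⟨a * b, by simpa using ha.mul hb⟩
  refine Submodule.span_le (p := (LinearMap.range _).comap (rhoV K N).toLinearMap).2 ?_ hv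
  rintro _ ⟨l, rfl, rfl⟩
  obtain ⟨a, ha, h⟩ := hword l
  exact ⟨_, h⟩

theorem rhoW_mem_range_lof {n : ℕ} {w : WDR K N} (hw : (w : VDR K N) ∈ degVDR K N n) :
    rhoW K N w ∈ LinearMap.range (DirectSum.lof K ℤ (filtWB K N).Piece n) :=
  AlgFiltration.mem_range_lof_of_grMap (grIncl_injective K N)
    ((grIncl_rhoW K N w).symm ▸ rhoV_mem_range_lof K N hw)

theorem rhoW_injective : Function.Injective (rhoW K N) := by
  refine Function.Injective.of_comp (f := grIncl K N) fun a b h => ?_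
  rw [Function.comp_apply, Function.comp_apply, grIncl_rhoW, grIncl_rhoW] at h
  exact Subtype.ext ((rhoV_bijective K N).1 h)

theorem mem_filtVB_of_mul_mem {i : ℤ} {v : VB K}
    (h : v * (bX K 1 1 - 1) ∈ (filtVB K N).F (i + 1)) : v ∈ (filtVB K N).F i := by
  refine AlgFiltration.mem_of_mul_mem (filtVB_eq_top K N le_rfl)
    (mem_filtVB_one K N (bX_one_one_sub_one_mem K N)) (fun y hy => ?_) h
  obtain ⟨u, rfl⟩ := rhoV_surjective K N y
  rw [← rhoV_e1, ← map_mul, map_eq_zero_iff _ (rhoV_bijective K N).1] at hy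
  rw [eq_zero_of_mul_e1_eq_zero K N hy, map_zero]

theorem algebraMap_add_mem_idealI {c : K} {v : VB K}
    (h : algebraMap K (VB K) c + v * (bX K 1 1 - 1) ∈ idealI K N) : c = 0 := by
  have h' : algebraMap K (VB K) c ∈ idealI K N :=
    (Submodule.add_mem_iff_left _ (idealI_mul_mem_left v (bX_one_one_sub_one_mem K N))).1 h
  have hc : algebraMap K (MonoidAlgebra K (rootsOfUnity N ℂ)) c = 0 :=
    ((algToMu K N).commutes c).symm.trans h'
  exact (map_eq_zero_iff _ (FaithfulSMul.algebraMap_injective K _)).1 hc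

theorem exists_eq_mul_of_mem_filtWB {i : ℤ} (hi : 0 ≤ i) {w : WB K}
    (hw : w ∈ (filtWB K N).F (i + 1)) :
    ∃ v ∈ (filtVB K N).F i, (w : VB K) = v * (bX K 1 1 - 1) := by
  obtain ⟨_, c, v, rfl⟩ := w
  have hw : algebraMap K (VB K) c + v * (bX K 1 1 - 1) ∈ (filtVB K N).F (i + 1) := hw
  have hI : algebraMap K (VB K) c + v * (bX K 1 1 - 1) ∈ idealI K N := by
    have hF := (filtVB K N).anti (show 1 ≤ i + 1 by omega) hw
    change _ ∈ filVB K N 1 at hF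
    rwa [filVB_of_pos one_pos, Int.toNat_one, pow_one] at hF
  obtain rfl := algebraMap_add_mem_idealI K N hI
  rw [map_zero, zero_add] at hw
  exact ⟨v, mem_filtVB_of_mul_mem K N hw, by simp⟩

theorem rhoW_surjective : Function.Surjective (rhoW K N) := by
  refine (AlgHom.range_eq_top _).1 (AlgFiltration.range_eq_top_of_le_clsPreimage _ fun i w hw =>
    AlgFiltration.mem_clsPreimage.2 ⟨hw, ?_⟩)
  have hx := mem_filtVB_one K N (bX_one_one_sub_one_mem K N)
  rcases lt_trichotomy i 0 with hi | rfl | hi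
  · have hw' : (w : VB K) ∈ (filtVB K N).F (i + 1) := by
      rw [filtVB_eq_top K N (by omega)]
      exact Submodule.mem_top
    rw [(AlgFiltration.cls_eq_zero_iff _ hw).2 hw']
    exact Subalgebra.zero_mem _
  · obtain ⟨_, c, v, rfl⟩ := w
    have hc : algebraMap K (WB K) c ∈ (filtWB K N).F 0 :=
      filtVB_zero K N (algebraMap K (VB K) c)
    rw [AlgFiltration.cls_sub_eq _ hw hc, AlgFiltration.cls_algebraMap]
    · exact Subalgebra.algebraMap_mem _ c
    · change algebraMap K (VB K) c + v * (bX K 1 1 - 1) - algebraMap K (VB K) c ∈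
        (filtVB K N).F (0 + 1)
      rw [add_sub_cancel_left]
      exact (filtVB K N).mul_mem (filtVB_zero K N v) hx
  · obtain ⟨i, rfl⟩ : ∃ j, i = j + 1 := ⟨i - 1, by omega⟩
    obtain ⟨v, hv, h⟩ := exists_eq_mul_of_mem_filtWB K N (by omega) hw
    obtain ⟨u, hu⟩ := rhoV_surjective K N ((filtVB K N).cls i v hv)
    refine ⟨⟨u * drι K N .e1, mul_mem_leftSub _ _⟩, grIncl_injective K N ?_⟩
    refine (grIncl_rhoW K N _).trans (Eq.trans ?_ (AlgFiltration.grMap_cls _ _ hw).symm)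
    rw [map_mul, hu, rhoV_e1, AlgFiltration.cls_mul]
    exact AlgFiltration.cls_congr _ rfl h.symm _ _

theorem rhoW_bijective : Function.Bijective (rhoW K N) :=
  ⟨rhoW_injective K N, rhoW_surjective K N⟩

/-- The leading coefficients on `W^B_N` with values in `W^DR_N`. -/
noncomputable def leadWB : AlgFiltration.LeadingCoeff (filtWB K N) (WDR K N) :=
  ((leadVB K N).restrict (WB K)).map (retractDR K N)

theorem leadWB_toGr_rhoW (w : WDR K N) : (leadWB K N).toGr (rhoW K N w) = w := by
  refine (AlgFiltration.LeadingCoeff.toGr_map _ _ _).trans ?_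
  refine (congrArg (retractDR K N) (AlgFiltration.LeadingCoeff.toGr_restrict _ _ _)).trans ?_
  change retractDR K N ((leadVB K N).toGr (grIncl K N (rhoW K N w))) = w
  rw [grIncl_rhoW, leadVB_toGr_rhoV, retractDR_coe]

theorem leadWB_toGr_bijective : Function.Bijective (leadWB K N).toGr := by
  refine (Function.Bijective.of_comp_iff _ (rhoW_bijective K N)).1 ?_
  rw [show (leadWB K N).toGr ∘ rhoW K N = id from funext (leadWB_toGr_rhoW K N)]
  exact Function.bijective_id

theorem grTensor_filtWB_bijective :
    Function.Bijective (AlgFiltration.grTensor (filtWB K N) (filtWB K N)) :=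
  AlgFiltration.grTensor_bijective (leadWB_toGr_bijective K N) (leadWB_toGr_bijective K N)

end RhoW

/-! ### The Betti coproduct is filtered -/

section MixedSum

theorem intSum_one_succ {M : Type*} [AddCommGroup M] (q : ℤ) (f : ℤ → M) :
    intSum 1 (q + 1) f = intSum 1 q f + f (q + 1) := by
  unfold intSum
  rcases lt_trichotomy q (-1) with h | rfl | h
  · rw [if_neg (by omega), if_neg (by omega),
      show Finset.Icc (q + 1) (1 - 1) = insert (q + 1) (Finset.Icc (q + 1 + 1) (1 - 1)) by
        ext; simp; omega, Finset.sum_insert (by simp)]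
    abel
  · simp
  · rw [if_pos (by omega), if_pos (by omega),
      show Finset.Icc 1 (q + 1) = insert (q + 1) (Finset.Icc 1 q) by ext; simp; omega,
      Finset.sum_insert (by simp), add_comm]

theorem map_intSum {M M' F : Type*} [AddCommGroup M] [AddCommGroup M'] [FunLike F M M']
    [AddMonoidHomClass F M M'] (φ : F) (p q : ℤ) (f : ℤ → M) :
    φ (intSum p q f) = intSum p q fun k => φ (f k) := by
  unfold intSum
  split_ifs <;> simp

variable {R : Type*} [CommRing R] {x y : ℤ → R}

/-- The sum `∑_{k=1}^{n-1} x_k y_{n-k}`. -/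
noncomputable def mixedSum (x y : ℤ → R) (n : ℤ) : R := intSum 1 (n - 1) fun k => x k * y (n - k)

theorem mixedSum_succ (hy : ∀ m n, y (m + n) = y m * y n) (n : ℤ) :
    mixedSum x y (n + 1) = y 1 * mixedSum x y n + x n * y 1 := by
  unfold mixedSum
  have h : ∀ (p q : ℤ) (f : ℤ → R), y 1 * intSum p q f = intSum p q fun k => y 1 * f k :=
    map_intSum (AddMonoidHom.mulLeft (y 1))
  rw [show n + 1 - 1 = n - 1 + 1 by ring, intSum_one_succ, h, sub_add_cancel, add_sub_cancel_left]
  congr 2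
  funext k
  rw [show n + 1 - k = 1 + (n - k) by ring, hy]
  ring

theorem mixedSum_add_nat (hx : ∀ m n, x (m + n) = x m * x n) (hy : ∀ m n, y (m + n) = y m * y n)
    (hy0 : y 0 = 1) (n : ℤ) (k : ℕ) :
    mixedSum x y (n + k) =
      y k * mixedSum x y n + x n * ∑ j ∈ Finset.range k, x j * y (k - j) := by
  induction k with
  | zero => simp [hy0]
  | succ k ih =>
    have h : ∀ j : ℕ, y ((k + 1 : ℕ) - j) = y 1 * y (k - j) := by
      intro j
      rw [← hy]
      congr 1
      push_cast
      ring
    rw [Nat.cast_succ, ← add_assoc, mixedSum_succ hy, ih, hx, ← Nat.cast_succ]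
    simp only [h, Finset.sum_range_succ, sub_self, hy0]
    simp only [mul_left_comm _ (y 1), ← Finset.mul_sum]
    rw [Nat.cast_succ, add_comm (k : ℤ) 1, hy]
    ring

/-- The closed form of the `m`-th iterated difference, with step `N`, of `mixedSum`. -/
noncomputable def mixedDiff (x y : ℤ → R) (N m : ℕ) (a : ℤ) : R :=
  (y N - 1) ^ m * mixedSum x y a + x a * (∑ j ∈ Finset.range N, x j * y (N - j)) *
    ∑ i ∈ Finset.range m, (x N - 1) ^ i * (y N - 1) ^ (m - 1 - i)

theorem mixedDiff_zero (N : ℕ) (a : ℤ) : mixedDiff x y N 0 a = mixedSum x y a := by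
  simp [mixedDiff]

theorem mixedDiff_succ (hx : ∀ m n, x (m + n) = x m * x n) (hy : ∀ m n, y (m + n) = y m * y n)
    (hy0 : y 0 = 1) (N m : ℕ) (a : ℤ) :
    mixedDiff x y N (m + 1) a = mixedDiff x y N m (a + N) - mixedDiff x y N m a := by
  have h : ∑ i ∈ Finset.range (m + 1), (x N - 1) ^ i * (y N - 1) ^ (m + 1 - 1 - i) =
      (y N - 1) ^ m + (x N - 1) *
        ∑ i ∈ Finset.range m, (x N - 1) ^ i * (y N - 1) ^ (m - 1 - i) := by
    rw [Finset.sum_range_succ', Finset.mul_sum, add_comm]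
    congr 1
    · simp
    · refine Finset.sum_congr rfl fun i _ => ?_
      rw [show m + 1 - 1 - (i + 1) = m - 1 - i by omega]
      ring
  unfold mixedDiff
  rw [h, mixedSum_add_nat hx hy hy0, hx]
  ring

end MixedSum

section BettiCoproduct

open LaurentPolynomial

variable (K : Type*) [CommRing K]

/-- The evaluation at `X₀` of Laurent polynomials. -/
noncomputable def evalX0 : LaurentPolynomial K →ₐ[K] VB K :=
  AddMonoidAlgebra.lift K _ _
    { toFun := fun n => bX K 0 n.toAdd
      map_one' := bX_zero K 0
      map_mul' := fun m n => bX_add K 0 m.toAdd n.toAdd }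

theorem evalX0_T (n : ℤ) : evalX0 K (T n) = bX K 0 n := by
  exact (AddMonoidAlgebra.lift_single _ _ _).trans (one_smul _ _)

/-- The map `p ↦ p(X₀) (X₁ - 1)`. -/
noncomputable def laurentY : LaurentPolynomial K →ₗ[K] WB K where
  toFun p := ⟨evalX0 K p * (bX K 1 1 - 1), mul_mem_leftSub _ _⟩
  map_add' p q := Subtype.ext (by simp [add_mul])
  map_smul' c p := Subtype.ext (by simp)

theorem laurentY_T (n : ℤ) : laurentY K (T n) = wY K n :=
  Subtype.ext (congrArg (· * (bX K 1 1 - 1)) (evalX0_T K n))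

theorem deltaB_spec : IsBettiCoproduct K (deltaB K) :=
  (existsUnique_isBettiCoproduct K).choose_spec.1

/-- The element `X^n ⊗ 1`. -/
noncomputable def laurentLeft (n : ℤ) : LaurentPolynomial K ⊗[K] LaurentPolynomial K := T n ⊗ₜ 1

/-- The element `1 ⊗ X^n`. -/
noncomputable def laurentRight (n : ℤ) : LaurentPolynomial K ⊗[K] LaurentPolynomial K := 1 ⊗ₜ T n

theorem laurentLeft_add (m n : ℤ) :
    laurentLeft K (m + n) = laurentLeft K m * laurentLeft K n := by
  rw [laurentLeft, T_add, laurentLeft, laurentLeft, Algebra.TensorProduct.tmul_mul_tmul, mul_one]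

theorem laurentRight_add (m n : ℤ) :
    laurentRight K (m + n) = laurentRight K m * laurentRight K n := by
  rw [laurentRight, T_add, laurentRight, laurentRight, Algebra.TensorProduct.tmul_mul_tmul, mul_one]

theorem laurentRight_zero : laurentRight K 0 = 1 := by
  simp [laurentRight, Algebra.TensorProduct.one_def]

theorem deltaB_laurentY_T (n : ℤ) : deltaB K (laurentY K (T n)) =
    laurentY K (T n) ⊗ₜ 1 + 1 ⊗ₜ laurentY K (T n) -
      TensorProduct.map (laurentY K) (laurentY K)
        (mixedSum (laurentLeft K) (laurentRight K) n) := by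
  rw [laurentY_T, (deltaB_spec K).2, mixedSum, map_intSum]
  simp only [laurentLeft, laurentRight, Algebra.TensorProduct.tmul_mul_tmul, one_mul, mul_one,
    TensorProduct.map_tmul, laurentY_T]

variable (N : ℕ)

/-- The element `(X₀^N - 1)^m X₀^a (X₁ - 1)` of `W^B`. -/
noncomputable def diffY (m : ℕ) (a : ℤ) : WB K := laurentY K ((T N - 1) ^ m * T a)

theorem coe_diffY (m : ℕ) (a : ℤ) :
    (diffY K N m a : VB K) = (bX K 0 N - 1) ^ m * bX K 0 a * (bX K 1 1 - 1) := by
  change evalX0 K ((T N - 1) ^ m * T a) * (bX K 1 1 - 1) = _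
  rw [map_mul, map_pow, map_sub, map_one, evalX0_T, evalX0_T]

theorem diffY_succ (m : ℕ) (a : ℤ) : diffY K N (m + 1) a = diffY K N m (a + N) - diffY K N m a := by
  unfold diffY
  rw [← map_sub, T_add]
  congr 1
  ring

theorem deltaB_diffY_eq_mixedDiff (m : ℕ) (a : ℤ) : deltaB K (diffY K N m a) =
    diffY K N m a ⊗ₜ 1 + 1 ⊗ₜ diffY K N m a -
      TensorProduct.map (laurentY K) (laurentY K)
        (mixedDiff (laurentLeft K) (laurentRight K) N m a) := by
  induction m generalizing a with
  | zero =>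
    rw [mixedDiff_zero, show diffY K N 0 a = laurentY K (T a) by simp [diffY], deltaB_laurentY_T]
  | succ m ih =>
    rw [mixedDiff_succ (laurentLeft_add K) (laurentRight_add K) (laurentRight_zero K), diffY_succ,
      map_sub, map_sub, ih, ih, TensorProduct.sub_tmul, TensorProduct.tmul_sub]
    abel

theorem map_laurentY_mixedDiff (m : ℕ) (a : ℤ) :
    TensorProduct.map (laurentY K) (laurentY K) (mixedDiff (laurentLeft K) (laurentRight K) N m a) =
      TensorProduct.map (laurentY K) (laurentY K)
          ((1 ⊗ₜ ((T N - 1) ^ m)) * mixedSum (laurentLeft K) (laurentRight K) a)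
        + ∑ i ∈ Finset.range m, ∑ j ∈ Finset.range N,
          diffY K N i (a + j) ⊗ₜ[K] diffY K N (m - 1 - i) (N - j) := by
  have h1 : laurentLeft K N - 1 = (T N - 1) ⊗ₜ 1 := by
    rw [TensorProduct.sub_tmul]; rfl
  have h2 : laurentRight K N - 1 = 1 ⊗ₜ (T N - 1) := by
    rw [TensorProduct.tmul_sub]; rfl
  rw [mixedDiff, h1, h2, map_add, Finset.mul_sum, map_sum, Algebra.TensorProduct.tmul_pow, one_pow]
  congr 1
  refine Finset.sum_congr rfl fun i _ => ?_
  rw [Finset.mul_sum, Finset.sum_mul, map_sum]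
  refine Finset.sum_congr rfl fun j _ => ?_
  simp only [laurentLeft, laurentRight, Algebra.TensorProduct.tmul_mul_tmul, one_mul, mul_one,
    TensorProduct.map_tmul, Algebra.TensorProduct.tmul_pow, one_pow, diffY]
  rw [T_add, mul_comm (T a * T j), mul_comm (T _) (_ ^ (m - 1 - i))]

theorem deltaB_diffY (m : ℕ) (a : ℤ) : deltaB K (diffY K N m a) =
    diffY K N m a ⊗ₜ 1 + 1 ⊗ₜ diffY K N m a
      - ∑ i ∈ Finset.range m, ∑ j ∈ Finset.range N,
          diffY K N i (a + j) ⊗ₜ[K] diffY K N (m - 1 - i) (N - j)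
      - TensorProduct.map (laurentY K) (laurentY K)
          ((1 ⊗ₜ ((T N - 1) ^ m)) * mixedSum (laurentLeft K) (laurentRight K) a) := by
  rw [deltaB_diffY_eq_mixedDiff, map_laurentY_mixedDiff]
  abel

variable {K N} in
theorem commute_bX_zero (a : ℤ) (n : ℕ) : Commute (bX K 0 a) ((bX K 0 N - 1) ^ n) := by
  refine Commute.pow_right (Commute.sub_right ?_ (Commute.one_right _)) n
  change bX K 0 a * bX K 0 N = bX K 0 N * bX K 0 a
  rw [← bX_add, ← bX_add, add_comm]

variable [NeZero N]

theorem bX_zero_sub_one_pow_mem (m : ℕ) : (bX K 0 N - 1) ^ m ∈ (filtVB K N).F m := by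
  induction m with
  | zero => exact filtVB_zero K N _
  | succ m ih =>
    rw [pow_succ, Nat.cast_succ]
    exact (filtVB K N).mul_mem ih (mem_filtVB_one K N (bX_zero_N_sub_one_mem K N))

theorem laurentY_mem (m : ℕ) (p : LaurentPolynomial K) :
    laurentY K ((T N - 1) ^ m * p) ∈ (filtWB K N).F (m + 1) := by
  change evalX0 K ((T N - 1) ^ m * p) * (bX K 1 1 - 1) ∈ (filtVB K N).F (m + 1)
  rw [map_mul, map_pow, map_sub, map_one, evalX0_T]
  have h := (filtVB K N).mul_mem (bX_zero_sub_one_pow_mem K N m) (filtVB_zero K N (evalX0 K p))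
  rw [add_zero] at h
  exact (filtVB K N).mul_mem h (mem_filtVB_one K N (bX_one_one_sub_one_mem K N))

theorem diffY_mem (m : ℕ) (a : ℤ) : diffY K N m a ∈ (filtWB K N).F (m + 1) := laurentY_mem K N m _

theorem map_laurentY_mem (m : ℕ) (z : LaurentPolynomial K ⊗[K] LaurentPolynomial K) :
    TensorProduct.map (laurentY K) (laurentY K) ((1 ⊗ₜ ((T N - 1) ^ m)) * z) ∈
      ((filtWB K N).tensor (filtWB K N)).F (m + 1 + 1) := by
  induction z using TensorProduct.induction_on with
  | zero => rw [mul_zero, map_zero]; exact Submodule.zero_mem _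
  | add z z' hz hz' => rw [mul_add, map_add]; exact Submodule.add_mem _ hz hz'
  | tmul p q =>
    rw [Algebra.TensorProduct.tmul_mul_tmul, one_mul, TensorProduct.map_tmul]
    have hp : laurentY K p ∈ (filtWB K N).F 1 := by
      simpa using laurentY_mem K N 0 p
    exact AlgFiltration.tmul_mem_tensor (by ring) hp (laurentY_mem K N m q)

theorem tmul_diffY_mem {i j m : ℕ} (h : i + j + 1 = m) (a b : ℤ) :
    diffY K N i a ⊗ₜ[K] diffY K N j b ∈ ((filtWB K N).tensor (filtWB K N)).F (m + 1) :=
  AlgFiltration.tmul_mem_tensor (by rw [← h]; push_cast; ring) (diffY_mem K N i a)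
    (diffY_mem K N j b)

theorem deltaB_diffY_mem (m : ℕ) (a : ℤ) :
    deltaB K (diffY K N m a) ∈ ((filtWB K N).tensor (filtWB K N)).F (m + 1) := by
  rw [deltaB_diffY]
  refine Submodule.sub_mem _ (Submodule.sub_mem _ (Submodule.add_mem _ ?_ ?_) ?_) ?_
  · exact AlgFiltration.tmul_mem_tensor (add_zero _) (diffY_mem K N m a) (filtWB K N).one_mem
  · exact AlgFiltration.tmul_mem_tensor (zero_add _) (filtWB K N).one_mem (diffY_mem K N m a)
  · refine Submodule.sum_mem _ fun i hi => Submodule.sum_mem _ fun j _ => tmul_diffY_mem K N ?_ _ _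
    rw [Finset.mem_range] at hi
    omega
  · exact AlgFiltration.anti _ (by omega) (map_laurentY_mem K N m _)

end BettiCoproduct

section DeltaFiltered

variable (K : Type*) [CommRing K] (N : ℕ) [NeZero N]

theorem tensor_filtWB_of_nonpos {m : ℤ} (hm : m ≤ 0) (z : WB K ⊗[K] WB K) :
    z ∈ ((filtWB K N).tensor (filtWB K N)).F m := by
  refine AlgFiltration.anti _ hm ?_
  induction z using TensorProduct.induction_on with
  | zero => exact Submodule.zero_mem _
  | add z z' hz hz' => exact Submodule.add_mem _ hz hz'
  | tmul a b =>
    exact AlgFiltration.tmul_mem_tensor (add_zero 0) (filtVB_zero K N a) (filtVB_zero K N b)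

/-- The elements `w ∈ W^B` such that `Δ^{W,B}(w) ∈ F^m`, as a submodule of `K F₂`. -/
noncomputable def deltaPreimage (m : ℤ) : Submodule K (VB K) :=
  (Submodule.comap (deltaB K).toLinearMap (((filtWB K N).tensor (filtWB K N)).F m)).map
    (WB K).val.toLinearMap

variable {K N}

theorem coe_mem_deltaPreimage {m : ℤ} {w : WB K} :
    (w : VB K) ∈ deltaPreimage K N m ↔
      deltaB K w ∈ ((filtWB K N).tensor (filtWB K N)).F m := by
  refine ⟨fun ⟨w', hw', h⟩ => ?_, fun h => ⟨w, h, rfl⟩⟩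
  obtain rfl : w' = w := Subtype.ext h
  exact hw'

theorem coe_mem_deltaPreimage_zero (w : WB K) : (w : VB K) ∈ deltaPreimage K N 0 :=
  coe_mem_deltaPreimage.2 (tensor_filtWB_of_nonpos K N le_rfl _)

theorem mul_mem_deltaPreimage {i j : ℤ} {a b : VB K} (ha : a ∈ deltaPreimage K N i)
    (hb : b ∈ deltaPreimage K N j) : a * b ∈ deltaPreimage K N (i + j) := by
  obtain ⟨a, ha, rfl⟩ := ha
  obtain ⟨b, hb, rfl⟩ := hb
  refine coe_mem_deltaPreimage (w := a * b).2 ?_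
  rw [map_mul]
  exact AlgFiltration.mul_mem _ ha hb

theorem deltaPreimage_anti {i j : ℤ} (h : i ≤ j) : deltaPreimage K N j ≤ deltaPreimage K N i :=
  Submodule.map_mono (Submodule.comap_mono (AlgFiltration.anti _ h))

theorem coe_diffY_mem_deltaPreimage (n : ℕ) (a : ℤ) :
    (diffY K N n a : VB K) ∈ deltaPreimage K N (n + 1) :=
  coe_mem_deltaPreimage.2 (deltaB_diffY_mem K N n a)

variable (K N)

/-- The span of the elements `(X₀^N - 1)^n X₀^a (X₁ - 1) w` with `Δ^{W,B}(w) ∈ F^(m-n-1)`. It is a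
left ideal of `K F₂`, whereas `W^B` is only a subalgebra. -/
noncomputable def deltaIdeal (m : ℤ) : Submodule K (VB K) :=
  Submodule.span K {u | ∃ (n : ℕ) (a : ℤ) (w : VB K), w ∈ deltaPreimage K N (m - n - 1) ∧
    u = diffY K N n a * w}

variable {K N}

theorem deltaIdeal_le (m : ℤ) : deltaIdeal K N m ≤ deltaPreimage K N m := by
  refine Submodule.span_le.2 ?_
  rintro _ ⟨n, a, w, hw, rfl⟩
  have h := mul_mem_deltaPreimage (coe_diffY_mem_deltaPreimage n a) hw
  rwa [show (n : ℤ) + 1 + (m - n - 1) = m by ring] at h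

theorem deltaIdeal_succ_le (m : ℤ) : deltaIdeal K N (m + 1) ≤ deltaIdeal K N m := by
  refine Submodule.span_mono ?_
  rintro _ ⟨n, a, w, hw, rfl⟩
  exact ⟨n, a, w, deltaPreimage_anti (by omega) hw, rfl⟩

theorem mul_mem_deltaIdeal {m m' : ℤ} {v u : VB K} (hu : u ∈ deltaIdeal K N m)
    (h : ∀ (n : ℕ) (a : ℤ) (w : VB K), w ∈ deltaPreimage K N (m - n - 1) →
      v * (diffY K N n a * w) ∈ deltaIdeal K N m') :
    v * u ∈ deltaIdeal K N m' := by
  suffices hle : deltaIdeal K N m ≤ (deltaIdeal K N m').comap (LinearMap.mulLeft K v) from hle hu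
  refine Submodule.span_le.2 ?_
  rintro _ ⟨n, a, w, hw, rfl⟩
  exact h n a w hw

theorem bX_zero_sub_one_mul_mem_deltaIdeal {m : ℤ} {u : VB K} (hu : u ∈ deltaIdeal K N m) :
    (bX K 0 N - 1) * u ∈ deltaIdeal K N (m + 1) := by
  refine mul_mem_deltaIdeal hu fun n a w hw => Submodule.subset_span ⟨n + 1, a, w, ?_, ?_⟩
  · rwa [show m + 1 - (n + 1 : ℕ) - 1 = m - n - 1 by push_cast; ring]
  · rw [coe_diffY, coe_diffY, pow_succ']
    simp only [mul_assoc]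

theorem bX_one_sub_one_mul_mem_deltaIdeal {m : ℤ} {w : VB K} (hw : w ∈ deltaPreimage K N m) :
    (bX K 1 1 - 1) * w ∈ deltaIdeal K N (m + 1) :=
  Submodule.subset_span ⟨0, 0, w, by simpa using hw, by simp [coe_diffY, bX_zero]⟩

theorem bX_zero_mem_leftStab_deltaIdeal {m : ℤ} (b : ℤ) :
    bX K 0 b ∈ leftStab (deltaIdeal K N m) := by
  intro u hu
  refine mul_mem_deltaIdeal hu fun n a w hw => Submodule.subset_span ⟨n, b + a, w, hw, ?_⟩
  rw [coe_diffY, coe_diffY, bX_add, ← mul_assoc _ (bX K 0 b), ← (commute_bX_zero b n).eq]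
  simp only [mul_assoc]

theorem bX_one_mem_leftStab_deltaIdeal {m : ℤ} : bX K 1 1 ∈ leftStab (deltaIdeal K N m) := by
  intro u hu
  have h := deltaIdeal_succ_le _ (bX_one_sub_one_mul_mem_deltaIdeal (deltaIdeal_le m hu))
  simpa [sub_mul] using Submodule.add_mem _ hu h

theorem bX_one_neg_mem_leftStab_deltaIdeal {m : ℤ} :
    bX K 1 (-1) ∈ leftStab (deltaIdeal K N m) := by
  intro u hu
  have hX : bX K 1 (-1) * u ∈ deltaPreimage K N (0 + m) :=
    mul_mem_deltaPreimage (coe_mem_deltaPreimage_zero (wX1inv K)) (deltaIdeal_le m hu)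
  rw [zero_add] at hX
  have h := Submodule.sub_mem _ hu
    (deltaIdeal_succ_le _ (bX_one_sub_one_mul_mem_deltaIdeal hX))
  rwa [sub_mul, one_mul, ← mul_assoc, ← bX_add, add_neg_cancel, bX_zero, one_mul,
    sub_sub_cancel] at h

theorem mem_leftStab_deltaIdeal (m : ℤ) (v : VB K) : v ∈ leftStab (deltaIdeal K N m) := by
  refine VB_mem_of_gen _ (Fin.forall_fin_two.2 ⟨?_, ?_⟩) (Fin.forall_fin_two.2 ⟨?_, ?_⟩) v
  · exact bX_zero_mem_leftStab_deltaIdeal 1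
  · exact bX_one_mem_leftStab_deltaIdeal
  · exact bX_zero_mem_leftStab_deltaIdeal (-1)
  · exact bX_one_neg_mem_leftStab_deltaIdeal

theorem idealI_mul_deltaIdeal_le (m : ℤ) :
    idealI K N * deltaIdeal K N m ≤ deltaIdeal K N (m + 1) :=
  idealI_mul_le (mem_leftStab_deltaIdeal m) (mem_leftStab_deltaIdeal (m + 1))
    (fun _ hu => bX_zero_sub_one_mul_mem_deltaIdeal hu)
    (fun _ hu => bX_one_sub_one_mul_mem_deltaIdeal (deltaIdeal_le m hu))

theorem mul_sub_one_mem_deltaIdeal {m : ℕ} {v : VB K} (hv : v ∈ (filtVB K N).F m) :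
    v * (bX K 1 1 - 1) ∈ deltaIdeal K N (m + 1) := by
  refine filtVB_le
    (P := fun m => (deltaIdeal K N (m + 1)).comap (LinearMap.mulRight K (bX K 1 1 - 1)))
    (eq_top_iff.2 fun v _ => ?_) (fun m => Submodule.mul_le.2 fun v hv u hu => ?_) m hv
  · have h := bX_one_sub_one_mul_mem_deltaIdeal (coe_mem_deltaPreimage_zero (N := N) (1 : WB K))
    exact mem_leftStab_deltaIdeal _ v _ (by simpa using h)
  · have h := idealI_mul_deltaIdeal_le _ (Submodule.mul_mem_mul hv hu)
    simpa [mul_assoc] using h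

variable (K N)

theorem isFiltered_deltaB :
    AlgFiltration.IsFiltered (filtWB K N) ((filtWB K N).tensor (filtWB K N)) (deltaB K) := by
  intro i w hw
  rcases le_or_gt i 0 with hi | hi
  · exact tensor_filtWB_of_nonpos K N hi _
  obtain ⟨m, rfl⟩ : ∃ m : ℕ, i = m + 1 := ⟨i.toNat - 1, by omega⟩
  obtain ⟨v, hv, h⟩ := exists_eq_mul_of_mem_filtWB K N m.cast_nonneg hw
  exact coe_mem_deltaPreimage.1 (h ▸ deltaIdeal_le _ (mul_sub_one_mem_deltaIdeal hv))

end DeltaFiltered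

/-! ### Compatibility of the coproducts -/

section Compatibility

variable (K : Type*) [CommRing K] (N : ℕ) [NeZero N]

theorem rhoV_e0_pow (m : ℕ) : rhoV K N (drι K N .e0 ^ m) =
    (filtVB K N).cls m ((bX K 0 N - 1) ^ m) (bX_zero_sub_one_pow_mem K N m) := by
  induction m with
  | zero =>
    rw [pow_zero, map_one, ← AlgFiltration.cls_one]
    exact AlgFiltration.cls_congr _ Nat.cast_zero.symm (pow_zero _).symm _ _
  | succ m ih =>
    rw [pow_succ, map_mul, ih, rhoV_e0, AlgFiltration.cls_mul]
    exact AlgFiltration.cls_congr _ (Nat.cast_succ m).symm (pow_succ _ _).symm _ _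

theorem rhoW_drZ (m : ℕ) (a : ℤ) : rhoW K N (drZ K N (m + 1) (zetaN N ^ a)) =
    -(filtWB K N).cls (m + 1) (diffY K N m a) (diffY_mem K N m a) := by
  apply grIncl_injective K N
  rw [grIncl_rhoW, map_neg]
  refine Eq.trans ?_ (congrArg Neg.neg (AlgFiltration.grMap_cls _ _ _).symm)
  change rhoV K N (-(drι K N .e0 ^ m * drι K N (.root (zetaN N ^ a))) * drι K N .e1) = _
  rw [neg_mul, map_neg, map_mul, map_mul, rhoV_e0_pow, rhoV_root, rhoV_e1, AlgFiltration.cls_mul,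
    AlgFiltration.cls_mul]
  refine congrArg Neg.neg ?_
  exact AlgFiltration.cls_congr _ (by ring) (coe_diffY K N m a).symm _ _

theorem deltaDR_drZ (m : ℕ) (a : ℤ) : deltaDR K N (drZ K N (m + 1) (zetaN N ^ a)) =
    drZ K N (m + 1) (zetaN N ^ a) ⊗ₜ 1 + 1 ⊗ₜ drZ K N (m + 1) (zetaN N ^ a) +
      ∑ i ∈ Finset.range m, ∑ j ∈ Finset.range N,
        drZ K N (i + 1) (zetaN N ^ (a + j)) ⊗ₜ[K]
          drZ K N (m - 1 - i + 1) (zetaN N ^ ((N : ℤ) - j)) := by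
  have hspec : IsDeRhamCoproduct K N (deltaDR K N) :=
    (existsUnique_isDeRhamCoproduct K N).choose_spec.1
  have hζ (j : ℕ) : zetaN N ^ a * (zetaN N ^ (a + j : ℤ))⁻¹ = zetaN N ^ ((N : ℤ) - j) := by
    rw [← zpow_neg, ← zpow_add, zpow_sub, zpow_natCast _ N, zetaN_pow, one_mul, ← zpow_neg]
    ring_nf
  rw [hspec (m + 1) (zetaN N ^ a) (by omega), Nat.add_sub_cancel, ← Finset.Ico_add_one_right_eq_Icc,
    Finset.sum_Ico_eq_sum_range, Nat.add_sub_cancel]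
  refine congrArg _ (Finset.sum_congr rfl fun i hi => ?_)
  rw [Finset.mem_range] at hi
  rw [← sum_range_zetaN_pow N _ a]
  refine Finset.sum_congr rfl fun j _ => ?_
  rw [hζ, add_comm 1 i, show m + 1 - (i + 1) = m - 1 - i + 1 by omega]

theorem hasCls_deltaB_diffY (m : ℕ) (a : ℤ) :
    ((filtWB K N).tensor (filtWB K N)).HasCls (m + 1) (deltaB K (diffY K N m a))
      (-AlgFiltration.grTensor (filtWB K N) (filtWB K N)
        (Algebra.TensorProduct.map (rhoW K N) (rhoW K N)
          (deltaDR K N (drZ K N (m + 1) (zetaN N ^ a))))) := by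
  have hl := AlgFiltration.hasCls_tmul (add_zero _) (diffY_mem K N m a) (filtWB K N).one_mem
  have hr := AlgFiltration.hasCls_tmul (zero_add _) (filtWB K N).one_mem (diffY_mem K N m a)
  have hs : ((filtWB K N).tensor (filtWB K N)).HasCls (m + 1) _ _ :=
    AlgFiltration.HasCls.sum (s := Finset.range m) fun i hi =>
      AlgFiltration.HasCls.sum (s := Finset.range N) fun j _ =>
        AlgFiltration.hasCls_tmul
          (by rw [Finset.mem_range] at hi; omega) (diffY_mem K N i (a + j))
          (diffY_mem K N (m - 1 - i) (N - j))
  have hz := AlgFiltration.hasCls_zero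
    (map_laurentY_mem K N m (mixedSum (laurentLeft K) (laurentRight K) a))
  have h := ((hl.add hr).sub hs).sub hz
  rw [← deltaB_diffY] at h
  convert h using 1
  rw [deltaDR_drZ]
  simp only [map_add, map_sum, Algebra.TensorProduct.map_tmul, rhoW_drZ, map_one,
    AlgFiltration.cls_one, TensorProduct.neg_tmul, TensorProduct.tmul_neg, neg_neg, map_neg]
  abel

variable {K N}

theorem grTensor_grDeltaB
    (hΔ : AlgFiltration.IsFiltered (filtWB K N) ((filtWB K N).tensor (filtWB K N)) (deltaB K))
    (hcan : Function.Bijective (AlgFiltration.grTensor (filtWB K N) (filtWB K N)))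
    (x : (filtWB K N).Gr) :
    AlgFiltration.grTensor (filtWB K N) (filtWB K N) (grDeltaB K N hΔ hcan x) =
      AlgFiltration.grMap (deltaB K) hΔ x :=
  (AlgEquiv.ofBijective (AlgFiltration.grTensor (filtWB K N) (filtWB K N)) hcan).apply_symm_apply _

theorem rhoW_comp_deltaDR
    (hΔ : AlgFiltration.IsFiltered (filtWB K N) ((filtWB K N).tensor (filtWB K N)) (deltaB K))
    (hcan : Function.Bijective (AlgFiltration.grTensor (filtWB K N) (filtWB K N))) :
    (Algebra.TensorProduct.map (rhoW K N) (rhoW K N)).comp (deltaDR K N) =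
      (grDeltaB K N hΔ hcan).comp (rhoW K N) := by
  refine WDR_hom_ext (A := (filtWB K N).Gr ⊗[K] (filtWB K N).Gr) fun n ζ hn => hcan.1 ?_
  obtain ⟨m, rfl⟩ : ∃ m, n = m + 1 := ⟨n - 1, by omega⟩
  obtain ⟨a, rfl⟩ := mem_zpowers_zetaN N ζ
  obtain ⟨h, hcls⟩ := hasCls_deltaB_diffY K N m a
  rw [AlgHom.comp_apply, AlgHom.comp_apply, grTensor_grDeltaB, rhoW_drZ, map_neg,
    AlgFiltration.grMap_cls, hcls, neg_neg]

end Compatibility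

theorem theorem1p6_general (K : Type*) [CommRing K] (N : ℕ) [NeZero N] :
    Function.Bijective (rhoW K N) ∧
    (∀ (n : ℕ) (w : WDR K N), (w : VDR K N) ∈ degVDR K N n →
      rhoW K N w ∈ LinearMap.range (DirectSum.lof K ℤ (filtWB K N).Piece n)) ∧
    ∃ (hΔ : AlgFiltration.IsFiltered (filtWB K N) ((filtWB K N).tensor (filtWB K N)) (deltaB K))
      (hcan : Function.Bijective (AlgFiltration.grTensor (filtWB K N) (filtWB K N))),
      (Algebra.TensorProduct.map (rhoW K N) (rhoW K N)).comp (deltaDR K N) =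
        (grDeltaB K N hΔ hcan).comp (rhoW K N) :=
  ⟨rhoW_bijective K N, fun _ _ hw => rhoW_mem_range_lof K N hw, isFiltered_deltaB K N,
    grTensor_filtWB_bijective K N, rhoW_comp_deltaDR _ _⟩

theorem theorem1p6 (K : Type*) [CommRing K] [Algebra ℚ K] (N : ℕ) [NeZero N] :
    -- `ρ^W_N` is a graded isomorphism
    Function.Bijective (rhoW K N) ∧
    (∀ (n : ℕ) (w : WDR K N), (w : VDR K N) ∈ degVDR K N n →
      rhoW K N w ∈ LinearMap.range (DirectSum.lof K ℤ (filtWB K N).Piece n)) ∧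
    -- `gr(Δ^{W,B})` exists and the diagram commutes
    ∃ (hΔ : AlgFiltration.IsFiltered (filtWB K N) ((filtWB K N).tensor (filtWB K N)) (deltaB K))
      (hcan : Function.Bijective (AlgFiltration.grTensor (filtWB K N) (filtWB K N))),
      (Algebra.TensorProduct.map (rhoW K N) (rhoW K N)).comp (deltaDR K N) =
        (grDeltaB K N hΔ hcan).comp (rhoW K N) := by
  exact theorem1p6_general K N
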